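/- Fix $\theta>0$ and integers $N\ge 1$, $q\ge 0$. Let $\mathcal F^N=\ell^2(\mathbb N_0)\otimes\mathbb C^N$ be the $N$-fold Fock module of the Moyal plane $\mathbb V_2^\theta$, with orthonormal basis $e_n^{(k)}$ ($n\ge0$, $0\le k<N$), and let $a,a^\dagger$ be the annihilation and creation operators $a\,e_n^{(k)}=\sqrt n\,e_{n-1}^{(k)}$, $a^\dagger e_n^{(k)}=\sqrt{n+1}\,e_{n+1}^{(k)}$ on their common domain $\mathcal D=\{\psi:\sum_{n,k}n|\psi_{n,k}|^2<\infty\}$. A gauge field of rank $N$ is a pair $A=(A_1,A_2)$ of bounded anti-Hermitean operators on $\mathcal F^N$; it determines the operators $$D=-\tfrac1{\sqrt{2\theta}}\,a^\dagger+\tfrac12(A_1-\mathrm iA_2),\qquad \overline D=\tfrac1{\sqrt{2\theta}}\,a+\tfrac12(A_1+\mathrm iA_2)$$ on $\mathcal D$ (so $\overline D=-D^\dagger$ on $\mathcal D$) and the curvature $F=2\mathrm i\big([\overline D,D]+\tfrac1{2\theta}\mathbf 1\big)$, the commutator being understood as the sesquilinear form $\langle\phi,[\overline D,D]\psi\rangle=\langle\overline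 D\phi,\overline D\psi\rangle-\langle D\phi,D\psi\rangle$ on $\mathcal D$. Let $\mathrm{Tr}$ be $2\pi\theta$ times the Hilbert space trace. A fluxon of K-theory charge $(N,q)$ is a gauge field $A$ of rank $N$ whose curvature is a bounded operator $F$ which satisfies the Yang--Mills equations $[D,F]=[\overline D,F]=0$ (in particular $F\mathcal D\subset\mathcal D$), such that $F$ is trace class with topological charge $\frac1{2\pi\mathrm i}\mathrm{Tr}(F)=q$ and the Yang--Mills action $-\frac12\mathrm{Tr}(F^2)$ is well-defined and finite. Two gauge fields are gauge equivalent if some unitary $U$ of $\mathcal F^N$ with $U\mathcal D=\mathcal D$ conjugates the operators $D,\overline D$ of the one into those of the other. The moduli space $\mathcal G_{N,q}(\mathbb V_2^\theta)$ is the set of gauge equivalence classes of fluxons of charge $(N,q)$, with the quotient of the operator norm topology on gauge fields. Then the moduli space is the $q$-th symmetric product orbifold $$\mathcal G_{N,q}(\mathbb V_2^\theta)\;\cong\;\mathrm{Sym}^q(\mathbb R^2)=(\mathbb R^2)^q/S_q .$$ More precisely, there is a homeomorphism $\mathrm{Sym}^q(\mathbb R^2)\to\mathcal G_{N,q}(\mathbb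 V_2^\theta)$ which sends the $S_q$-orbit of $(\lambda_0,\dots,\lambda_{q-1})\in\mathbb C^q\cong(\mathbb R^2)^q$ to the gauge equivalence class of the explicit fluxon with positions $\lambda_i$: on the first copy of $\mathcal F$ it is $$D=\sum_{i=0}^{q-1}\lambda_i\,e_i\otimes e_i^*-S^q c^\dagger (S^\dagger)^q,\qquad \overline D=-\sum_{i=0}^{q-1}\overline{\lambda_i}\,e_i\otimes e_i^*+S^q c\,(S^\dagger)^q,$$ where $c=\frac1{\sqrt{2\theta}}a$ and $S e_n=e_{n+1}$, and on the remaining $N-1$ copies $D=-c^\dagger$, $\overline D=c$. -/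

import Mathlib

open scoped lp ComplexConjugate

noncomputable section

namespace Fluxon

/-! ### Fock modules and their ladder operators -/

/-- The `N`-fold Fock module `𝓕ᴺ = ℓ²(ℕ) ⊗ ℂᴺ`.  Elements of the (operator) algebra
`Mat_N` over the Moyal plane, i.e. endomorphisms of the free module of rank `N`,
are realised as operators on this Hilbert space. -/
abbrev FockSpace (N : ℕ) : Type := ℓ²(ℕ × Fin N, ℂ)

/-- Bounded operators on the `N`-fold Fock module. -/
abbrev Operators (N : ℕ) : Type := FockSpace N →L[ℂ] FockSpace N

lemma summable_normSq {N : ℕ} (ψ : FockSpace N) : Summable fun p => ‖ψ p‖ ^ 2 := by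
  have h := lp.memℓp ψ
  rw [memℓp_gen_iff (by norm_num)] at h
  simpa using h

/-- The common domain of the annihilation and creation operators: all `ψ` with
`∑ n |ψ(n,k)|² < ∞`. -/
def numberDomain (N : ℕ) : Submodule ℂ (FockSpace N) where
  carrier := {ψ | Summable fun p : ℕ × Fin N => (p.1 : ℝ) * ‖ψ p‖ ^ 2}
  zero_mem' := by simp [summable_zero]
  add_mem' := by
    intro a b ha hb
    refine Summable.of_nonneg_of_le (fun p => by positivity) (fun p => ?_)
      ((ha.mul_left 2).add (hb.mul_left 2))
    have h1 : ‖(a + b) p‖ ≤ ‖a p‖ + ‖b p‖ := norm_add_le (a p) (b p)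
    have h2 : ‖(a + b) p‖ ^ 2 ≤ 2 * ‖a p‖ ^ 2 + 2 * ‖b p‖ ^ 2 := by
      nlinarith [sq_nonneg (‖a p‖ - ‖b p‖), norm_nonneg ((a + b) p), norm_nonneg (a p),
        norm_nonneg (b p)]
    have h3 := mul_le_mul_of_nonneg_left h2 (Nat.cast_nonneg (α := ℝ) p.1)
    linarith
  smul_mem' := by
    intro c a ha
    have h : Summable fun p : ℕ × Fin N => ‖c‖ ^ 2 * ((p.1 : ℝ) * ‖a p‖ ^ 2) := ha.mul_left _
    refine h.congr (fun p => ?_)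
    have : (c • a) p = c * a p := rfl
    rw [this, norm_mul]
    ring

lemma mem_numberDomain {N : ℕ} {ψ : FockSpace N} :
    ψ ∈ numberDomain N ↔ Summable fun p : ℕ × Fin N => (p.1 : ℝ) * ‖ψ p‖ ^ 2 := Iff.rfl

lemma memℓp_annihilation {N : ℕ} (ψ : numberDomain N) :
    Memℓp (fun p : ℕ × Fin N => ((√((p.1 : ℝ) + 1) : ℝ) : ℂ) * (ψ : FockSpace N) (p.1 + 1, p.2))
      2 := by
  rw [memℓp_gen_iff (by norm_num)]
  have hinj : Function.Injective (fun p : ℕ × Fin N => (p.1 + 1, p.2)) := by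
    rintro ⟨a, b⟩ ⟨c, d⟩ h
    simpa using h
  refine ((mem_numberDomain.1 ψ.2).comp_injective hinj).congr (fun p => ?_)
  have h0 : (0 : ℝ) ≤ (p.1 : ℝ) + 1 := by positivity
  simp [mul_pow, Real.sq_sqrt h0]

lemma memℓp_creation {N : ℕ} (ψ : numberDomain N) :
    Memℓp (fun p : ℕ × Fin N => ((√(p.1 : ℝ) : ℝ) : ℂ) * (ψ : FockSpace N) (p.1 - 1, p.2))
      2 := by
  rw [memℓp_gen_iff (by norm_num)]
  have hinj : Function.Injective (fun p : ℕ × Fin N => (p.1 + 1, p.2)) := by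
    rintro ⟨a, b⟩ ⟨c, d⟩ h
    simpa using h
  rw [← hinj.summable_iff]
  · refine ((mem_numberDomain.1 ψ.2).add (summable_normSq (ψ : FockSpace N))).congr (fun p => ?_)
    have h0 : (0 : ℝ) ≤ (p.1 : ℝ) + 1 := by positivity
    simp [mul_pow, Real.sq_sqrt h0]
    ring
  · rintro ⟨n, k⟩ h
    rcases n with _ | n
    · simp
    · exact absurd ⟨(n, k), rfl⟩ h

/-- The annihilation operator `a ⊗ 1_N`, with `a e_n = √n e_{n-1}`. -/
def annihilation (N : ℕ) : numberDomain N →ₗ[ℂ] FockSpace N where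
  toFun ψ := ⟨_, memℓp_annihilation ψ⟩
  map_add' ψ φ := by
    ext p
    exact mul_add _ _ _
  map_smul' c ψ := by
    ext p
    exact mul_left_comm _ _ _

/-- The creation operator `a† ⊗ 1_N`, with `a† e_n = √(n+1) e_{n+1}`. -/
def creation (N : ℕ) : numberDomain N →ₗ[ℂ] FockSpace N where
  toFun ψ := ⟨_, memℓp_creation ψ⟩
  map_add' ψ φ := by
    ext p
    exact mul_add _ _ _
  map_smul' c ψ := by
    ext p
    exact mul_left_comm _ _ _

/-- The number basis vector `e_n^{(k)}`, `p = (n, k)`. -/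
def numberBasis {N : ℕ} (p : ℕ × Fin N) : numberDomain N :=
  ⟨lp.single 2 p (1 : ℂ), by
    rw [mem_numberDomain]
    refine summable_of_ne_finset_zero (s := {p}) (fun r hr => ?_)
    have : r ≠ p := by simpa using hr
    rw [lp.single_apply_ne (hij := this)]
    simp⟩

/-! ### Gauge fields, covariant derivatives, curvature -/

/-- A gauge field of rank `N`: a pair `(A₁, A₂)` (indexed by `0, 1`) of anti-Hermitean
elements of the operator algebra, with the operator norm topology. -/
abbrev GaugeField (N : ℕ) : Type := Fin 2 → skewAdjoint (Operators N)

/-- `D = -(2θ)^{-1/2} a† + (A₁ - i A₂)/2`. -/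
def covD (θ : ℝ) {N : ℕ} (A : GaugeField N) : numberDomain N →ₗ[ℂ] FockSpace N :=
  -(((1 / √(2 * θ) : ℝ) : ℂ) • creation N) +
    (((1 / 2 : ℂ) • ((A 0 : Operators N) - Complex.I • (A 1 : Operators N)) : Operators N) :
      FockSpace N →ₗ[ℂ] FockSpace N) ∘ₗ (numberDomain N).subtype

/-- `D̄ = (2θ)^{-1/2} a + (A₁ + i A₂)/2`. -/
def covDbar (θ : ℝ) {N : ℕ} (A : GaugeField N) : numberDomain N →ₗ[ℂ] FockSpace N :=
  ((1 / √(2 * θ) : ℝ) : ℂ) • annihilation N +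
    (((1 / 2 : ℂ) • ((A 0 : Operators N) + Complex.I • (A 1 : Operators N)) : Operators N) :
      FockSpace N →ₗ[ℂ] FockSpace N) ∘ₗ (numberDomain N).subtype

/-- The bounded operator `F` is the curvature `F₁₂ = 2i ([D̄, D] + (2θ)⁻¹ 1)` of the gauge
field `A`.  The commutator is taken in the sense of forms on the domain of the ladder
operators: since `D† = -D̄` there,
`⟨φ, [D̄, D] ψ⟩ = ⟨D̄ φ, D̄ ψ⟩ - ⟨D φ, D ψ⟩`.  The domain is dense, so `F` is unique. -/
def IsCurvature (θ : ℝ) {N : ℕ} (A : GaugeField N) (F : Operators N) : Prop :=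
  ∀ φ ψ : numberDomain N,
    inner ℂ (φ : FockSpace N) (F ψ) =
      2 * Complex.I * (inner ℂ (covDbar θ A φ) (covDbar θ A ψ)
        - inner ℂ (covD θ A φ) (covD θ A ψ)
        + (1 / (2 * θ) : ℂ) * inner ℂ (φ : FockSpace N) (ψ : FockSpace N))

/-- The Yang-Mills equations `[D, F] = [D̄, F] = 0`, equivalently
`[D, [D̄, D]] = [D̄, [D̄, D]] = 0`, for a gauge field with curvature `F`. -/
def YangMillsEquations (θ : ℝ) {N : ℕ} (A : GaugeField N) (F : Operators N) : Prop :=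
  ∀ ψ : numberDomain N, ∃ h : F ψ ∈ numberDomain N,
    covD θ A ⟨F ψ, h⟩ = F (covD θ A ψ) ∧ covDbar θ A ⟨F ψ, h⟩ = F (covDbar θ A ψ)

/-- `Tr T` is well-defined and equal to `t`, where `Tr` is the invariant trace of the Moyal
plane (the integral of the Wigner function), i.e. `2πθ` times the Hilbert space trace.
A bounded operator is trace class iff its diagonal sums converge absolutely in every
orthonormal basis. -/
def HasTrace (θ : ℝ) {N : ℕ} (T : Operators N) (t : ℂ) : Prop :=
  ∀ b : HilbertBasis (ℕ × Fin N) ℂ (FockSpace N),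
    HasSum (fun p => (2 * Real.pi * θ : ℂ) * inner ℂ (b p) (T (b p))) t

/-- A fluxon of K-theory charge `(N, q)`: a gauge field on the free module of rank `N`
solving the Yang-Mills equations, with topological charge (first Chern number)
`(2πi)⁻¹ Tr F = q`, whose Yang-Mills action `-½ Tr F²` is well-defined and finite. -/
def IsFluxon (θ : ℝ) (N q : ℕ) (A : GaugeField N) : Prop :=
  ∃ F : Operators N, IsCurvature θ A F ∧ YangMillsEquations θ A F ∧
    HasTrace θ F (2 * Real.pi * Complex.I * q) ∧
    ∃ S : ℝ, HasTrace θ (F ∘L F) (-2 * S)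

/-! ### The moduli space -/

/-- Gauge equivalence: a unitary `U` with `D' = U D U⁻¹` and `D̄' = U D̄ U⁻¹` as (unbounded)
operators, i.e. `A'_i = U ∂_i(U⁻¹) + U A_i U⁻¹`. -/
def GaugeEquiv (θ : ℝ) {N : ℕ} (A A' : GaugeField N) : Prop :=
  ∃ U : FockSpace N ≃ₗᵢ[ℂ] FockSpace N,
    (∀ ψ : FockSpace N, U ψ ∈ numberDomain N ↔ ψ ∈ numberDomain N) ∧
    ∀ (ψ : numberDomain N) (h : U ψ ∈ numberDomain N),
      covD θ A' ⟨U ψ, h⟩ = U (covD θ A ψ) ∧ covDbar θ A' ⟨U ψ, h⟩ = U (covDbar θ A ψ)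

lemma gaugeEquiv_equivalence (θ : ℝ) (N : ℕ) : Equivalence (GaugeEquiv θ (N := N)) where
  refl A := ⟨LinearIsometryEquiv.refl ℂ _, fun _ => Iff.rfl, fun _ _ => ⟨rfl, rfl⟩⟩
  symm := by
    rintro A A' ⟨U, hU, h⟩
    have hs : ∀ ψ : FockSpace N, U.symm ψ ∈ numberDomain N ↔ ψ ∈ numberDomain N := fun ψ => by
      rw [← hU (U.symm ψ), U.apply_symm_apply]
    refine ⟨U.symm, hs, fun ψ hψ => ?_⟩
    have hψ' : U (U.symm ψ) ∈ numberDomain N := (hU _).2 hψ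
    have h1 := h ⟨U.symm ψ, hψ⟩ hψ'
    have h2 : (⟨U (U.symm ψ), hψ'⟩ : numberDomain N) = ψ := Subtype.ext (U.apply_symm_apply _)
    simp only [h2] at h1
    exact ⟨by rw [h1.1, U.symm_apply_apply], by rw [h1.2, U.symm_apply_apply]⟩
  trans := by
    rintro A B C ⟨U, hU, h⟩ ⟨V, hV, k⟩
    refine ⟨U.trans V, fun ψ => (hV _).trans (hU _), fun ψ hψ => ?_⟩
    have hψ' : U ψ ∈ numberDomain N := (hU _).2 ψ.2
    have h1 := h ψ hψ'
    have h2 := k ⟨U ψ, hψ'⟩ hψ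
    exact ⟨h2.1.trans (congrArg V h1.1), h2.2.trans (congrArg V h1.2)⟩

/-- The space of all fluxons of K-theory charge `(N, q)`, as a subspace of the space of
gauge fields. -/
abbrev FluxonSpace (θ : ℝ) (N q : ℕ) : Type := {A : GaugeField N // IsFluxon θ N q A}

/-- Gauge equivalence of fluxons. -/
def gaugeSetoid (θ : ℝ) (N q : ℕ) : Setoid (FluxonSpace θ N q) where
  r A A' := GaugeEquiv θ A.1 A'.1
  iseqv := ⟨fun A => (gaugeEquiv_equivalence θ N).refl A.1,
    fun h => (gaugeEquiv_equivalence θ N).symm h,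
    fun h h' => (gaugeEquiv_equivalence θ N).trans h h'⟩

/-- The moduli space of fluxons of K-theory charge `(N, q)`: gauge equivalence classes of
fluxons, with the quotient topology. -/
abbrev ModuliSpace (θ : ℝ) (N q : ℕ) : Type := Quotient (gaugeSetoid θ N q)

/-! ### The symmetric product and the explicit fluxons -/

/-- The orbit relation of `S_q` permuting the entries of a `q`-tuple. -/
def permSetoid (X : Type) (q : ℕ) : Setoid (Fin q → X) where
  r x y := ∃ σ : Equiv.Perm (Fin q), y = x ∘ σ
  iseqv := by
    refine ⟨fun x => ⟨1, rfl⟩, ?_, ?_⟩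
    · rintro x y ⟨σ, rfl⟩
      exact ⟨σ⁻¹, by ext i; simp⟩
    · rintro x y z ⟨σ, rfl⟩ ⟨τ, rfl⟩
      exact ⟨σ * τ, by ext i; simp⟩

/-- The symmetric product `Sym^q(X) = X^q / S_q`, with the quotient topology. -/
abbrev SymmetricProduct (X : Type) (q : ℕ) : Type := Quotient (permSetoid X q)

/-- The identification of the plane `ℝ²` with `ℂ`. -/
def planeToComplex (x : EuclideanSpace ℝ (Fin 2)) : ℂ := ⟨x 0, x 1⟩

/-- `A` is the explicit fluxon with positions `l₀, …, l_{q-1}`, given by its action on the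
number basis.  On the first copy of the Fock module
`D = ∑ᵢ lᵢ eᵢ ⊗ eᵢ* - S^q c† (S†)^q` and `D̄ = -∑ᵢ l̄ᵢ eᵢ ⊗ eᵢ* + S^q c (S†)^q`
with `c = (2θ)^{-1/2} a` and `S` the shift; on the other copies `D = -c†`, `D̄ = c`. -/
def IsStandardFluxon (θ : ℝ) {N q : ℕ} (l : Fin q → ℂ) (A : GaugeField N) : Prop :=
  ∀ (n : ℕ) (k : Fin N),
    (∀ h : k.val = 0 ∧ n < q,
      covD θ A (numberBasis (n, k)) = l ⟨n, h.2⟩ • (numberBasis (n, k) : FockSpace N) ∧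
      covDbar θ A (numberBasis (n, k)) =
        -(conj (l ⟨n, h.2⟩)) • (numberBasis (n, k) : FockSpace N)) ∧
    (k.val = 0 → q ≤ n →
      covD θ A (numberBasis (n, k)) =
        -((√(((n - q : ℕ) + 1 : ℝ) / (2 * θ)) : ℝ) : ℂ) •
          (numberBasis (n + 1, k) : FockSpace N) ∧
      covDbar θ A (numberBasis (n, k)) =
        ((√(((n - q : ℕ) : ℝ) / (2 * θ)) : ℝ) : ℂ) • (numberBasis (n - 1, k) : FockSpace N)) ∧
    (k.val ≠ 0 →
      covD θ A (numberBasis (n, k)) =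
        -((√(((n : ℝ) + 1) / (2 * θ)) : ℝ) : ℂ) • (numberBasis (n + 1, k) : FockSpace N) ∧
      covDbar θ A (numberBasis (n, k)) =
        ((√((n : ℝ) / (2 * θ)) : ℝ) : ℂ) • (numberBasis (n - 1, k) : FockSpace N))

end Fluxon

end

/-! Put `T = D̄`, `T' = -D` and `κ = 1/(2θ)`. Both are bounded perturbations of multiples of `a` and
`a†`, so on the common domain they are exactly adjoint to each other, and `G = F/(2i)` is `T'T - TT'
+ κ` in the sense of forms. The Yang-Mills equations say that `G` commutes with `T` and `T'`, hence
with `K = (1 + T'T)⁻¹`. Since `K` is compact, the joint eigenvectors of `K` and `G` span a dense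
subspace.

For `g ≠ 0` the `g`-eigenspace of `G` is finite-dimensional because `F` has a trace. There `T'T -
TT' = g - κ` is a commutator of matrices, so its trace vanishes and `g = κ`. On the `κ`-eigenspace
`T` and `T'` therefore commute and are diagonalised together; the eigenvalues `-l i` of `T'` give
the positions. On the kernel of `G` the canonical commutation relation `TT' - T'T = κ` holds, and
the oscillator argument produces copies of the Fock representation over a finite-dimensional space
of vacua. This is `exists_ladderBasis`. The number of vacua is `N` because it does not change under
bounded perturbations (`card_le`), and the number of eigenvectors is `q` by the trace of `F`; see
`IsFluxon.exists_fluxonBasis`.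

A ladder basis with given positions determines the pair `(T, T')`, its domain included, up to a
unitary (`maps_unitary`), so gauge classes correspond to unordered tuples of positions. That the
tuple is well defined, and that it depends continuously on the gauge field, both follow from the
perturbation estimate `exists_perm_eigenvalues`. In the other direction the explicit fluxon depends
continuously on its positions. -/

noncomputable section
namespace Fluxon

/-! ### Mutually adjoint operators on a common domain -/

section AdjointPair

variable {H : Type*} [NormedAddCommGroup H] [InnerProductSpace ℂ H] {𝒟 : Submodule ℂ H}

/-- `x` lies in the domain of the operator `T`, and `T x = y`. -/
def Maps (T : 𝒟 →ₗ[ℂ] H) (x y : H) : Prop := ∃ h : x ∈ 𝒟, T ⟨x, h⟩ = y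

namespace Maps

variable {T : 𝒟 →ₗ[ℂ] H} {x y x' y' : H}

lemma mem (h : Maps T x y) : x ∈ 𝒟 := h.1

lemma of_coe (φ : 𝒟) : Maps T φ (T φ) := ⟨φ.2, rfl⟩

lemma unique (h : Maps T x y) (h' : Maps T x y') : y = y' := h.2.symm.trans h'.2

lemma zero : Maps T 0 0 := ⟨𝒟.zero_mem, T.map_zero⟩

lemma add (h : Maps T x y) (h' : Maps T x' y') : Maps T (x + x') (y + y') :=
  ⟨𝒟.add_mem h.1 h'.1, by rw [← h.2, ← h'.2, ← map_add]; rfl⟩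

lemma smul (c : ℂ) (h : Maps T x y) : Maps T (c • x) (c • y) :=
  ⟨𝒟.smul_mem c h.1, by rw [← h.2, ← map_smul]; rfl⟩

lemma sub (h : Maps T x y) (h' : Maps T x' y') : Maps T (x - x') (y - y') :=
  ⟨𝒟.sub_mem h.1 h'.1, by rw [← h.2, ← h'.2, ← map_sub]; rfl⟩

lemma sum {ι : Type*} (s : Finset ι) {f g : ι → H} (h : ∀ i ∈ s, Maps T (f i) (g i)) :
    Maps T (∑ i ∈ s, f i) (∑ i ∈ s, g i) := by
  classical
  induction s using Finset.induction_on with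
  | empty => simpa using zero
  | insert a s ha ih =>
    rw [Finset.sum_insert ha, Finset.sum_insert ha]
    exact (h a (by simp)).add (ih fun i hi => h i (by simp [hi]))

end Maps

/-- `T` and `T'` are densely defined operators with the same domain which are exactly the
Hilbert space adjoints of each other. -/
structure AdjointPair (T T' : 𝒟 →ₗ[ℂ] H) : Prop where
  maps_left : ∀ {x y : H}, Maps T x y ↔ ∀ φ : 𝒟, inner ℂ (T' φ) x = inner ℂ (φ : H) y
  maps_right : ∀ {x y : H}, Maps T' x y ↔ ∀ φ : 𝒟, inner ℂ (T φ) x = inner ℂ (φ : H) y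

namespace AdjointPair

variable {T T' : 𝒟 →ₗ[ℂ] H} {x y x' y' : H}

lemma symm (h : AdjointPair T T') : AdjointPair T' T := ⟨h.maps_right, h.maps_left⟩

/-- Density of the domain is contained in the definition: if `x` is orthogonal to `𝒟`, then `(0, x)`
satisfies the condition for the graph of `T`, which is single-valued. -/
lemma eq_zero_of_inner (h : AdjointPair T T') (hx : ∀ φ : 𝒟, inner ℂ (φ : H) x = 0) : x = 0 :=
  (h.maps_left.2 fun φ => by rw [inner_zero_right, hx]).unique Maps.zero

lemma eq_of_inner (h : AdjointPair T T') (hx : ∀ φ : 𝒟, inner ℂ (φ : H) x = inner ℂ (φ : H) y) :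
    x = y :=
  sub_eq_zero.1 (h.eq_zero_of_inner fun φ => by rw [inner_sub_right, hx, sub_self])

lemma inner_eq (h : AdjointPair T T') (hx : Maps T x x') (hy : Maps T' y y') :
    inner ℂ x' y = inner ℂ x y' := by
  rw [← hx.2]
  exact h.maps_right.1 hy ⟨x, hx.1⟩

lemma inner_eq' (h : AdjointPair T T') (hx : Maps T x x') (hy : Maps T' y y') :
    inner ℂ y' x = inner ℂ y x' := h.symm.inner_eq hy hx

end AdjointPair

end AdjointPair

/-! ### Operators acting as weighted shifts on a Hilbert basis -/

section HilbertBasis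

variable {H : Type*} [NormedAddCommGroup H] [InnerProductSpace ℂ H] {J : Type*}

lemma hilbertBasis_ext (b : HilbertBasis J ℂ H) {x y : H}
    (h : ∀ j, inner ℂ (b j) x = inner ℂ (b j) y) : x = y := by
  apply b.repr.injective
  ext j
  rw [b.repr_apply_apply, b.repr_apply_apply, h]

lemma hilbertBasis_hasSum_norm_sq (b : HilbertBasis J ℂ H) (x : H) :
    HasSum (fun j => ‖inner ℂ (b j) x‖ ^ 2) (‖x‖ ^ 2) := by
  have h := b.hasSum_inner_mul_inner x x
  rw [inner_self_eq_norm_sq_to_K] at h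
  have h2 : (fun j => inner ℂ x (b j) * inner ℂ (b j) x) =
      fun j => ((‖inner ℂ (b j) x‖ ^ 2 : ℝ) : ℂ) := by
    funext j
    rw [← inner_conj_symm, Complex.conj_mul']
    push_cast
    rfl
  rw [h2] at h
  refine Complex.hasSum_ofReal.1 ?_
  push_cast at h ⊢
  exact h

lemma hilbertBasis_inner_eq [DecidableEq J] (b : HilbertBasis J ℂ H) (i j : J) :
    inner ℂ (b i) (b j) = if i = j then (1 : ℂ) else 0 :=
  orthonormal_iff_ite.1 b.orthonormal i j

lemma exists_hilbertBasis_reindex [CompleteSpace H] {J' : Type*} (b : HilbertBasis J ℂ H)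
    (e : J' ≃ J) : ∃ b' : HilbertBasis J' ℂ H, ∀ j, b' j = b (e j) := by
  have hsp : (Submodule.span ℂ (Set.range (b ∘ e)))ᗮ = ⊥ := by
    rw [e.surjective.range_comp, ← Submodule.orthogonal_closure, b.dense_span,
      Submodule.top_orthogonal_eq_bot]
  exact ⟨HilbertBasis.mkOfOrthogonalEqBot (b.orthonormal.comp e e.injective) hsp,
    fun j => congrFun (HilbertBasis.coe_mkOfOrthogonalEqBot _ hsp) j⟩

end HilbertBasis

section ShiftBasis

variable {H : Type*} [NormedAddCommGroup H] [InnerProductSpace ℂ H] {𝒟 : Submodule ℂ H}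
  {J : Type*}

/-- In the Hilbert basis `b` the operator `T'` is the weighted shift `b j ↦ σ j • b (s j)`, and
`T` is its adjoint. -/
structure IsShiftBasis (T T' : 𝒟 →ₗ[ℂ] H) (s : J → J) (σ : J → ℂ) (b : HilbertBasis J ℂ H) :
    Prop where
  injective : Function.Injective s
  right : ∀ j, Maps T' (b j) (σ j • b (s j))
  left : ∀ j, Maps T (b (s j)) (conj (σ j) • b j)
  left_zero : ∀ j, j ∉ Set.range s → Maps T (b j) 0

namespace IsShiftBasis

variable {T T' : 𝒟 →ₗ[ℂ] H} {s : J → J} {σ : J → ℂ} {b : HilbertBasis J ℂ H} {x y x' y' : H}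

lemma inner_left (hb : IsShiftBasis T T' s σ b) (h : AdjointPair T T') (hx : Maps T x y) (j : J) :
    inner ℂ (b j) y = conj (σ j) * inner ℂ (b (s j)) x := by
  rw [← h.inner_eq' hx (hb.right j), inner_smul_left]

lemma inner_right (hb : IsShiftBasis T T' s σ b) (h : AdjointPair T T') (hx : Maps T' x y) (j : J) :
    inner ℂ (b (s j)) y = σ j * inner ℂ (b j) x := by
  rw [← h.inner_eq (hb.left j) hx, inner_smul_left, Complex.conj_conj]

lemma inner_right_zero (hb : IsShiftBasis T T' s σ b) (h : AdjointPair T T') (hx : Maps T' x y)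
    {j : J} (hj : j ∉ Set.range s) : inner ℂ (b j) y = 0 := by
  rw [← h.inner_eq (hb.left_zero j hj) hx, inner_zero_left]

/-- A pair of vectors whose coordinates are related by the weighted shift. -/
lemma shift_pairing (hs : Function.Injective s) (b : HilbertBasis J ℂ H)
    (hy : ∀ j, inner ℂ (b (s j)) y = σ j * inner ℂ (b j) x)
    (hy0 : ∀ j, j ∉ Set.range s → inner ℂ (b j) y = 0)
    (hy' : ∀ j, inner ℂ (b j) y' = conj (σ j) * inner ℂ (b (s j)) x') :
    inner ℂ y x' = inner ℂ x y' := by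
  have h1 := b.hasSum_inner_mul_inner y x'
  have h2 := b.hasSum_inner_mul_inner x y'
  rw [← hs.hasSum_iff] at h1
  · refine h1.unique (h2.congr_fun ?_) |>.trans rfl
    intro j
    simp only [Function.comp]
    rw [← inner_conj_symm, hy, hy', map_mul, inner_conj_symm]
    ring
  · intro j hj
    rw [← inner_conj_symm, hy0 j hj]
    simp

/-- The action of `T` in a shift basis follows from the action of `T'`. -/
lemma of_right (h : AdjointPair T T') (hs : Function.Injective s)
    (hr : ∀ j, Maps T' (b j) (σ j • b (s j))) : IsShiftBasis T T' s σ b := by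
  classical
  -- `T` and `T'` share their domain, so `b i` already lies in the domain of `T` and only the
  -- coordinates of its image are in question.
  have key : ∀ i y, (∀ j, inner ℂ (b j) y = conj (σ j) * inner ℂ (b (s j)) (b i)) →
      Maps T (b i) y := by
    intro i y hy
    refine ⟨(hr i).mem, hilbertBasis_ext b fun j => ?_⟩
    rw [hy, ← h.inner_eq' (Maps.of_coe ⟨b i, (hr i).mem⟩) (hr j), inner_smul_left]
  refine ⟨hs, hr, fun j => key _ _ fun k => ?_, fun j hj => key _ _ fun k => ?_⟩
  · rw [inner_smul_right, hilbertBasis_inner_eq, hilbertBasis_inner_eq]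
    by_cases hkj : k = j
    · rw [hkj, if_pos rfl, if_pos rfl]
    · rw [if_neg hkj, if_neg (hs.ne hkj), mul_zero, mul_zero]
  · rw [inner_zero_right, hilbertBasis_inner_eq, if_neg, mul_zero]
    rintro rfl
    exact hj ⟨k, rfl⟩

/-- Nothing places `x` in `𝒟` beforehand: `T` is the full adjoint of `T'`, so a vector `y` with the
right coordinates suffices. Thus the shift data determine the domain. -/
lemma maps_left (hb : IsShiftBasis T T' s σ b) (h : AdjointPair T T')
    (hy : ∀ j, inner ℂ (b j) y = conj (σ j) * inner ℂ (b (s j)) x) : Maps T x y :=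
  h.maps_left.2 fun φ => shift_pairing hb.injective b (hb.inner_right h (Maps.of_coe φ))
    (fun _ => hb.inner_right_zero h (Maps.of_coe φ)) hy

lemma maps_right (hb : IsShiftBasis T T' s σ b) (h : AdjointPair T T')
    (hy : ∀ j, inner ℂ (b (s j)) y = σ j * inner ℂ (b j) x)
    (hy0 : ∀ j, j ∉ Set.range s → inner ℂ (b j) y = 0) : Maps T' x y :=
  h.maps_right.2 fun φ => by
    rw [← inner_conj_symm, ← inner_conj_symm (φ : H),
      shift_pairing hb.injective b hy hy0 (hb.inner_left h (Maps.of_coe φ))]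

lemma hasSum_inner_left (hb : IsShiftBasis T T' s σ b) (h : AdjointPair T T') (hx : Maps T x x')
    (hy : Maps T y y') : HasSum (fun j => (‖σ j‖ ^ 2 : ℂ) *
      (inner ℂ x (b (s j)) * inner ℂ (b (s j)) y)) (inner ℂ x' y') := by
  refine (b.hasSum_inner_mul_inner x' y').congr_fun fun j => ?_
  rw [hb.inner_left h hy, ← inner_conj_symm x' (b j), hb.inner_left h hx, map_mul, inner_conj_symm,
    ← Complex.conj_mul' (σ j), Complex.conj_conj]
  ring

lemma hasSum_inner_right (hb : IsShiftBasis T T' s σ b) (h : AdjointPair T T') (hx : Maps T' x x')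
    (hy : Maps T' y y') : HasSum (fun j => (‖σ j‖ ^ 2 : ℂ) *
      (inner ℂ x (b j) * inner ℂ (b j) y)) (inner ℂ x' y') := by
  have h1 := b.hasSum_inner_mul_inner x' y'
  rw [← hb.injective.hasSum_iff] at h1
  · refine h1.congr_fun fun j => ?_
    simp only [Function.comp]
    rw [hb.inner_right h hy, ← inner_conj_symm x' (b (s j)), hb.inner_right h hx, map_mul, inner_conj_symm,
      ← Complex.conj_mul' (σ j)]
    ring
  · intro j hj
    rw [hb.inner_right_zero h hy hj, mul_zero]

lemma hasSum_norm_sq_left (hb : IsShiftBasis T T' s σ b) (h : AdjointPair T T')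
    (hx : Maps T x x') :
    HasSum (fun j => ‖σ j‖ ^ 2 * ‖inner ℂ (b (s j)) x‖ ^ 2) (‖x'‖ ^ 2) := by
  refine (hilbertBasis_hasSum_norm_sq b x').congr_fun fun j => ?_
  rw [hb.inner_left h hx, norm_mul, mul_pow, RCLike.norm_conj]

/-- Two pairs of operators which act by the same weighted shift are intertwined by the unitary
between the two bases. -/
lemma maps_unitary {S S' : 𝒟 →ₗ[ℂ] H} {c : HilbertBasis J ℂ H}
    (hb : IsShiftBasis T T' s σ b) (h : AdjointPair T T')
    (hc : IsShiftBasis S S' s σ c) (h' : AdjointPair S S') :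
    (∀ x y, Maps T x y → Maps S (c.repr.symm (b.repr x)) (c.repr.symm (b.repr y))) ∧
      ∀ x y, Maps T' x y → Maps S' (c.repr.symm (b.repr x)) (c.repr.symm (b.repr y)) := by
  have key : ∀ j z, inner ℂ (c j) (c.repr.symm (b.repr z)) = inner ℂ (b j) z := fun j z => by
    rw [← c.repr_apply_apply, ← b.repr_apply_apply, LinearIsometryEquiv.apply_symm_apply]
  refine ⟨fun x y hxy => hc.maps_left h' fun j => ?_, fun x y hxy => hc.maps_right h' (fun j => ?_)
    fun j hj => ?_⟩
  · rw [key, key, hb.inner_left h hxy]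
  · rw [key, key, hb.inner_right h hxy]
  · rw [key, hb.inner_right_zero h hxy hj]

end IsShiftBasis

end ShiftBasis
end Fluxon
namespace Fluxon

/-! ### Ladder bases -/

/-- The index map of a ladder: it fixes the indices in `Fin q` and raises the level of the
others. -/
def ladderShift (q : ℕ) (ι : Type*) : Fin q ⊕ ℕ × ι → Fin q ⊕ ℕ × ι :=
  Sum.map id (Prod.map Nat.succ id)

/-- The weights of a ladder: eigenvalues `-l i` and the weights `√((n+1)κ)` of a creation
operator. -/
def ladderWeight {q : ℕ} {ι : Type*} (κ : ℝ) (l : Fin q → ℂ) : Fin q ⊕ ℕ × ι → ℂ :=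
  Sum.elim (fun i => -l i) (fun p => ((√(((p.1 : ℝ) + 1) * κ) : ℝ) : ℂ))

lemma ladderShift_injective (q : ℕ) (ι : Type*) : Function.Injective (ladderShift q ι) :=
  Sum.map_injective.2 ⟨Function.injective_id, Nat.succ_injective.prodMap Function.injective_id⟩

lemma inr_zero_notMem_range {q : ℕ} {ι : Type*} (k : ι) :
    Sum.inr (0, k) ∉ Set.range (ladderShift q ι) := by
  rintro ⟨i | ⟨n, j⟩, h⟩ <;> simp [ladderShift] at h

lemma exists_inr_zero_of_notMem_range {q : ℕ} {ι : Type*} {j : Fin q ⊕ ℕ × ι}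
    (hj : j ∉ Set.range (ladderShift q ι)) : ∃ k, j = Sum.inr (0, k) := by
  rcases j with i | ⟨n, k⟩
  · exact absurd ⟨Sum.inl i, rfl⟩ hj
  · rcases n with _ | n
    · exact ⟨k, rfl⟩
    · exact absurd ⟨Sum.inr (n, k), rfl⟩ hj

section Ladder

variable {H : Type*} [NormedAddCommGroup H] [InnerProductSpace ℂ H] {𝒟 : Submodule ℂ H}
  {q q' : ℕ} {ι ι' : Type*} {T T' S S' : 𝒟 →ₗ[ℂ] H} {κ : ℝ} {l : Fin q → ℂ} {l' : Fin q' → ℂ}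

/-- A Hilbert basis consisting of `q` joint eigenvectors of `T'` and `T` and of copies (labelled
by `ι`) of the number basis, on which `T'` acts as a creation operator. -/
abbrev IsLadderBasis (T T' : 𝒟 →ₗ[ℂ] H) (κ : ℝ) (l : Fin q → ℂ)
    (b : HilbertBasis (Fin q ⊕ ℕ × ι) ℂ H) : Prop :=
  IsShiftBasis T T' (ladderShift q ι) (ladderWeight κ l) b

namespace IsLadderBasis

variable {b : HilbertBasis (Fin q ⊕ ℕ × ι) ℂ H} {c : HilbertBasis (Fin q' ⊕ ℕ × ι') ℂ H}
  {x y x' y' x'' y'' : H}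

lemma right_inl (hb : IsLadderBasis T T' κ l b) (i : Fin q) :
    Maps T' (b (.inl i)) (-l i • b (.inl i)) := hb.right (.inl i)

lemma left_inl (hb : IsLadderBasis T T' κ l b) (i : Fin q) :
    Maps T (b (.inl i)) (-conj (l i) • b (.inl i)) := by
  simpa [ladderShift, ladderWeight] using hb.left (.inl i)

lemma norm_sq_weight (hκ : 0 ≤ κ) (p : ℕ × ι) :
    ‖ladderWeight κ l (.inr p)‖ ^ 2 = ((p.1 : ℝ) + 1) * κ := by
  have h0 : 0 ≤ ((p.1 : ℝ) + 1) * κ := by positivity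
  simp only [ladderWeight, Sum.elim_inr, Complex.norm_real, Real.norm_eq_abs, sq_abs]
  exact Real.sq_sqrt h0

/-- The commutator of `T'` and `T` in the sense of forms. -/
lemma form_eq (hb : IsLadderBasis T T' κ l b) (h : AdjointPair T T') (hκ : 0 ≤ κ)
    (hx : Maps T x x') (hy : Maps T y y') (hx' : Maps T' x x'') (hy' : Maps T' y y'') :
    inner ℂ x' y' - inner ℂ x'' y'' + κ * inner ℂ x y =
      κ * ∑ i, inner ℂ x (b (.inl i)) * inner ℂ (b (.inl i)) y := by
  set t : Fin q ⊕ ℕ × ι → ℂ := fun j => inner ℂ x (b j) * inner ℂ (b j) y with ht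
  -- `ρ` is the diagonal of `T'T`: `‖l i‖²` on eigenvectors and `nκ` at level `n`. The diagonal of
  -- `TT'` has the same `‖l i‖²` but `(n+1)κ`, so after adding `κ` only the eigenvectors contribute.
  set ρ : Fin q ⊕ ℕ × ι → ℂ := Sum.elim (fun i => (‖l i‖ : ℂ) ^ 2) (fun p => p.1 * κ) with hρ
  have hw : ∀ p : ℕ × ι, (‖ladderWeight κ l (.inr p)‖ : ℂ) ^ 2 = ((p.1 : ℂ) + 1) * κ := by
    intro p
    have := norm_sq_weight (l := l) hκ p
    exact_mod_cast congrArg (fun r : ℝ => (r : ℂ)) this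
  have h1 : HasSum (fun j => ρ j * t j) (inner ℂ x' y') := by
    -- The indices outside the range of the shift are those of level `0`, where `ρ` vanishes.
    rw [← hb.injective.hasSum_iff]
    · refine (hb.hasSum_inner_left h hx hy).congr_fun ?_
      rintro (i | p)
      · simp [hρ, ht, ladderShift, ladderWeight]
      · rw [hw]
        simp [hρ, ht, ladderShift]
    · intro j hj
      obtain ⟨k, rfl⟩ := exists_inr_zero_of_notMem_range hj
      simp [hρ]
  have h2 := hb.hasSum_inner_right h hx' hy'
  have h3 := (b.hasSum_inner_mul_inner x y).mul_left (κ : ℂ)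
  have h4 := (h1.sub h2).add h3
  have h5 := hasSum_sum_of_ne_finset_zero (L := .unconditional _) (s := Finset.univ.map Function.Embedding.inl)
    (f := (Sum.elim (fun i => κ * t (.inl i)) fun _ : ℕ × ι => 0)) (by
      rintro (i | p) hj
      · simp at hj
      · rfl)
  rw [Finset.sum_map] at h5
  rw [Finset.mul_sum]
  refine h4.unique (h5.congr_fun ?_)
  rintro (i | p)
  · simp [hρ, ht, ladderWeight]
  · rw [hw]
    simp [hρ, ht]
    ring

/-! ### Stability of vacua and eigenvalues under bounded perturbations. -/

lemma norm_sq_le (hb : IsLadderBasis T T' κ l b) (h : AdjointPair T T') (hκ : 0 ≤ κ) (m : ℕ)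
    (hx : Maps T x y) (h0 : ∀ i, inner ℂ (b (.inl i)) x = 0)
    (h1 : ∀ n k, m ≤ n → inner ℂ (b (.inr (n, k))) x = 0) : ‖y‖ ^ 2 ≤ m * κ * ‖x‖ ^ 2 := by
  refine hasSum_le_inj (ladderShift q ι) hb.injective (fun j _ => by positivity) ?_
    (hb.hasSum_norm_sq_left h hx) ((hilbertBasis_hasSum_norm_sq b x).mul_left (m * κ))
  rintro (i | ⟨n, k⟩)
  · simp [ladderShift, h0]
  · rw [norm_sq_weight hκ]
    rcases lt_or_ge (n + 1) m with hn | hn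
    · gcongr
      simp only
      exact_mod_cast hn.le
    · simp [ladderShift, h1 (n + 1) k hn]

/-- Counterpart of `norm_sq_le`. As `T'T` equals `nκ` at level `n`, low levels give upper bounds and
high levels lower bounds; `card_le` plays one ladder against the other. -/
lemma le_norm_sq (hb : IsLadderBasis T T' κ l b) (h : AdjointPair T T') (hκ : 0 ≤ κ) (m : ℕ)
    (hx : Maps T x y) (h0 : ∀ i, inner ℂ (b (.inl i)) x = 0)
    (h1 : ∀ n k, n ≤ m → inner ℂ (b (.inr (n, k))) x = 0) : m * κ * ‖x‖ ^ 2 ≤ ‖y‖ ^ 2 := by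
  have h2 := (hilbertBasis_hasSum_norm_sq b x).mul_left (m * κ)
  rw [← hb.injective.hasSum_iff] at h2
  · refine hasSum_le ?_ h2 (hb.hasSum_norm_sq_left h hx)
    rintro (i | ⟨n, k⟩)
    · simp [ladderShift, h0]
    · rw [norm_sq_weight hκ]
      rcases lt_or_ge n m with hn | hn
      · simp [ladderShift, h1 (n + 1) k hn]
      · simp only [Function.comp]
        gcongr
        have : (m : ℝ) ≤ n := by exact_mod_cast hn
        linarith
  · intro j hj
    obtain ⟨k, rfl⟩ := exists_inr_zero_of_notMem_range hj
    simp [h1 0 k (Nat.zero_le m)]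

/-- The number of vacua is stable under bounded perturbations. -/
theorem card_le [Fintype ι] [Fintype ι'] (hb : IsLadderBasis T T' κ l b) (h : AdjointPair T T')
    (hc : IsLadderBasis S S' κ l' c) (h' : AdjointPair S S') (hκ : 0 < κ) {C : ℝ}
    (hC : ∀ φ : 𝒟, ‖T φ - S φ‖ ≤ C * ‖(φ : H)‖) : Fintype.card ι ≤ Fintype.card ι' := by
  classical
  obtain ⟨r, hr⟩ := exists_nat_gt (C / √κ)
  have hκ' : 0 < √κ := Real.sqrt_pos.2 hκ
  rw [div_lt_iff₀ hκ'] at hr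
  -- Squares appear because `‖T x‖` grows like the square root of the level: a difference of `r`
  -- between square roots of levels means `r√κ > C` in norm.
  have key : ∀ t : ℕ, t ^ 2 * Fintype.card ι ≤ q' + ((t + r) ^ 2 + 1) * Fintype.card ι' := by
    intro t
    by_contra! hlt
    let f : (Fin (t ^ 2) × ι → ℂ) →ₗ[ℂ] H :=
      Fintype.linearCombination ℂ fun p => b (.inr (p.1, p.2))
    let g : H →ₗ[ℂ] (Fin q' ⊕ Fin ((t + r) ^ 2 + 1) × ι' → ℂ) :=
      LinearMap.pi fun j => (innerSL ℂ (c (Sum.map id (Prod.map (fun n : Fin _ => (n : ℕ)) id) j))).toLinearMap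
    -- By dimension, some nonzero combination of the levels of `b` below `t²` is orthogonal to the
    -- eigenvectors of `c` and to its levels up to `(t+r)²`. On it `T` has norm at most `t√κ` and
    -- `S` at least `(t+r)√κ`, against the bound `C`.
    have hker : LinearMap.ker (g ∘ₗ f) ≠ ⊥ := by
      apply LinearMap.ker_ne_bot_of_finrank_lt
      simpa using hlt
    obtain ⟨v, hv, hv0⟩ := (Submodule.ne_bot_iff _).1 hker
    have hfv : f v = ∑ p, v p • b (.inr ((p.1 : ℕ), p.2)) := rfl
    have hx0 : f v ≠ 0 := by
      intro h0
      apply hv0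
      funext p
      have : inner ℂ (b (.inr ((p.1 : ℕ), p.2))) (f v) = v p := by
        rw [hfv, inner_sum, Finset.sum_eq_single p]
        · rw [inner_smul_right, hilbertBasis_inner_eq]
          simp
        · intro p' _ hp
          rw [inner_smul_right, hilbertBasis_inner_eq, if_neg, mul_zero]
          intro he
          apply hp
          simp only [Sum.inr.injEq, Prod.mk.injEq] at he
          exact Prod.ext (Fin.ext he.1.symm) he.2.symm
        · simp
      rw [← this, h0, inner_zero_right]
      rfl
    have hmem : f v ∈ 𝒟 := by
      rw [hfv]
      exact Submodule.sum_mem _ fun p _ => 𝒟.smul_mem _ (hb.right _).mem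
    have hzero : ∀ j : Fin q ⊕ ℕ × ι, (∀ p : Fin (t ^ 2) × ι, j ≠ .inr ((p.1 : ℕ), p.2)) →
        inner ℂ (b j) (f v) = 0 := by
      intro j hj
      rw [hfv, inner_sum]
      refine Finset.sum_eq_zero fun p _ => ?_
      rw [inner_smul_right, hilbertBasis_inner_eq, if_neg (hj p), mul_zero]
    have hg : ∀ j : Fin q' ⊕ Fin ((t + r) ^ 2 + 1) × ι',
        inner ℂ (c (Sum.map id (Prod.map (fun n : Fin _ => (n : ℕ)) id) j)) (f v) = 0 :=
      fun j => congrFun (LinearMap.mem_ker.1 hv) j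
    have hT := hb.norm_sq_le h hκ.le (t ^ 2) (Maps.of_coe (T := T) ⟨f v, hmem⟩)
      (fun i => hzero _ fun p => by simp) (fun n k hn => hzero _ fun p he => by
        simp only [Sum.inr.injEq, Prod.mk.injEq] at he
        exact absurd p.1.2 (by omega))
    have hS := hc.le_norm_sq h' hκ.le ((t + r) ^ 2) (Maps.of_coe (T := S) ⟨f v, hmem⟩)
      (fun i => hg (.inl i)) (fun n k hn => hg (.inr (⟨n, by omega⟩, k)))
    have hx : 0 < ‖f v‖ := norm_pos_iff.2 hx0
    have hT' : ‖T ⟨f v, hmem⟩‖ ≤ t * √κ * ‖f v‖ := by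
      refine le_of_sq_le_sq ?_ (by positivity)
      refine hT.trans (le_of_eq ?_)
      rw [mul_pow, mul_pow, Real.sq_sqrt hκ.le]
      push_cast
      rfl
    have hS' : (t + r) * √κ * ‖f v‖ ≤ ‖S ⟨f v, hmem⟩‖ := by
      refine le_of_sq_le_sq ?_ (norm_nonneg _)
      refine (le_of_eq ?_).trans hS
      rw [mul_pow, mul_pow, Real.sq_sqrt hκ.le]
      push_cast
      rfl
    have h3 := norm_sub_norm_le (S ⟨f v, hmem⟩) (T ⟨f v, hmem⟩)
    rw [norm_sub_rev] at h3
    have h4 := hC ⟨f v, hmem⟩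
    simp only at h4
    have h5 := mul_lt_mul_of_pos_right hr hx
    nlinarith
  by_contra! hlt
  -- With `d = card ι' < card ι`, the bound `key` implies `t² ≤ q' + (2tr + r² + 1)d`. This value of
  -- `t` makes `t²` larger than the right-hand side.
  have h1 := key (q' + (2 * r + r ^ 2 + 1) * Fintype.card ι' + 1)
  generalize Fintype.card ι = a at *
  generalize Fintype.card ι' = d at *
  set t := q' + (2 * r + r ^ 2 + 1) * d + 1 with ht
  have h2 : t ^ 2 * (d + 1) ≤ t ^ 2 * a := Nat.mul_le_mul_left _ hlt
  have h3 : t * t = t * q' + t * (2 * r * d) + t * (r ^ 2 * d) + t * d + t := by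
    nth_rewrite 2 [ht]
    ring
  have h4 : 1 ≤ t := by omega
  have h5 : q' ≤ t * q' := Nat.le_mul_of_pos_left _ h4
  have h6 : r ^ 2 * d ≤ t * (r ^ 2 * d) := Nat.le_mul_of_pos_left _ h4
  have h7 : d ≤ t * d := Nat.le_mul_of_pos_left _ h4
  nlinarith

/-- The distance of an approximate eigenvector to the span of the eigenvectors. -/
lemma norm_sub_sum_sq_le (hb : IsLadderBasis T T' κ l b) (h : AdjointPair T T') (hκ : 0 ≤ κ)
    (hx : Maps T' x y) (z : ℂ) :
    κ * ‖x - ∑ i, inner ℂ (b (.inl i)) x • b (.inl i)‖ ^ 2 ≤ ‖y - z • x‖ ^ 2 := by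
  classical
  set p := ∑ i, inner ℂ (b (.inl i)) x • b (.inl i) with hp
  set p' := ∑ i, inner ℂ (b (.inl i)) x • (-l i • b (.inl i)) with hp'
  have hmp : Maps T' p p' := Maps.sum _ fun i _ => (hb.right_inl i).smul _
  have hm := hx.sub hmp
  obtain ⟨w, hw⟩ : ∃ w, Maps T (x - p) w := ⟨_, hm.mem, rfl⟩
  have hp0 : ∀ i, inner ℂ (b (.inl i)) (x - p) = 0 := fun i => by
    simp only [hp, inner_sub_right, inner_sum, inner_smul_right, hilbertBasis_inner_eq]
    simp
  have hp1 : ∀ i, inner ℂ (b (.inl i)) (y - p') = 0 := fun i => by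
    have := hb.inner_right h hm (.inl i)
    rwa [hp0, mul_zero] at this
  have hform := hb.form_eq h hκ hw hw hm hm
  rw [Finset.sum_eq_zero fun i _ => by rw [hp0, mul_zero], mul_zero,
    inner_self_eq_norm_sq_to_K, inner_self_eq_norm_sq_to_K, inner_self_eq_norm_sq_to_K] at hform
  have hform' : ‖w‖ ^ 2 - ‖y - p'‖ ^ 2 + κ * ‖x - p‖ ^ 2 = 0 := by
    have : ((‖w‖ ^ 2 - ‖y - p'‖ ^ 2 + κ * ‖x - p‖ ^ 2 : ℝ) : ℂ) = 0 := by
      push_cast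
      exact hform
    exact_mod_cast this
  have hinner := h.inner_eq hw hm
  -- Off the eigenvectors `TT' = T'T + κ`, and subtracting the scalars `z` and `conj z` leaves the
  -- commutator unchanged. Hence `T' - z` is bounded below there by `√κ`.
  have e1 : ‖(y - p') - z • (x - p)‖ ^ 2 = ‖w - conj z • (x - p)‖ ^ 2 + κ * ‖x - p‖ ^ 2 := by
    rw [norm_sub_sq (𝕜 := ℂ) (y - p') (z • (x - p)), norm_sub_sq (𝕜 := ℂ) w, inner_smul_right, inner_smul_right, hinner,
      ← inner_conj_symm (x - p), ← map_mul, RCLike.conj_re, norm_smul, norm_smul, RCLike.norm_conj]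
    linarith
  have e2 : y - z • x = ((y - p') - z • (x - p)) + (p' - z • p) := by
    rw [smul_sub]
    abel
  -- The span of the eigenvectors and its complement are both preserved, so the two parts of the
  -- error obey Pythagoras.
  have e3 : inner ℂ (p' - z • p) ((y - p') - z • (x - p)) = 0 := by
    have : ∀ i, inner ℂ (b (.inl i)) ((y - p') - z • (x - p)) = 0 := fun i => by
      rw [inner_sub_right, inner_smul_right, hp0, hp1, mul_zero, sub_zero]
    generalize (y - p') - z • (x - p) = v at this ⊢
    simp only [hp, hp', inner_sub_left, inner_smul_left, sum_inner, this, mul_zero,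
      Finset.sum_const_zero, sub_zero]
  rw [e2, @norm_add_sq ℂ, ← inner_conj_symm, e3, map_zero, map_zero, e1]
  nlinarith [sq_nonneg ‖w - conj z • (x - p)‖, sq_nonneg ‖p' - z • p‖]

end IsLadderBasis

/-- If `M* M` is near `1`, continuity of the determinant keeps `|det M|` above `1/2`. The Leibniz
expansion has `q!` terms, so some permutation has product greater than `1/(2 q!)`; as all entries
are at most `1` in norm, each factor of that product is at least as large. -/
lemma exists_perm_of_almost_isometry (q : ℕ) : ∃ δ > 0, ∀ M : Matrix (Fin q) (Fin q) ℂ,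
    (∀ i j, ‖M i j‖ ≤ 1) → (∀ i j, ‖(M.conjTranspose * M) i j - (1 : Matrix _ _ ℂ) i j‖ < δ) →
    ∃ τ : Equiv.Perm (Fin q), ∀ i, 1 ≤ 2 * q.factorial * ‖M (τ i) i‖ := by
  have hcont : Continuous fun Z : Fin q → Fin q → ℂ => (Matrix.of Z).det :=
    Continuous.matrix_det continuous_id
  obtain ⟨δ, hδ, h⟩ := Metric.continuous_iff.1 hcont (1 : Matrix (Fin q) (Fin q) ℂ) (3 / 4)
    (by norm_num)
  refine ⟨δ, hδ, fun M hM hd => ?_⟩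
  have h1 := h (M.conjTranspose * M : Matrix (Fin q) (Fin q) ℂ)
    ((dist_pi_lt_iff hδ).2 fun i => (dist_pi_lt_iff hδ).2 fun j => by
      rw [dist_eq_norm]
      exact hd i j)
  have h1' : ‖(M.conjTranspose * M).det - 1‖ < 3 / 4 := by
    rw [dist_eq_norm] at h1
    have : (Matrix.of (1 : Matrix (Fin q) (Fin q) ℂ)).det = 1 := Matrix.det_one
    rw [this] at h1
    exact h1
  rw [Matrix.det_mul, Matrix.det_conjTranspose] at h1'
  have h2 : (1 : ℝ) / 2 < ‖M.det‖ := by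
    have h3 := norm_sub_norm_le (1 : ℂ) (star M.det * M.det)
    rw [norm_one, norm_sub_rev, norm_mul, norm_star] at h3
    nlinarith [norm_nonneg M.det]
  by_contra! hcon
  have hprod : ∀ τ : Equiv.Perm (Fin q), 2 * q.factorial * ∏ i, ‖M (τ i) i‖ ≤ 1 := by
    intro τ
    obtain ⟨i, hi⟩ := hcon τ
    have : ∏ j, ‖M (τ j) j‖ ≤ ‖M (τ i) i‖ := by
      rw [← Finset.mul_prod_erase _ _ (Finset.mem_univ i)]
      exact mul_le_of_le_one_right (norm_nonneg _)
        (Finset.prod_le_one (fun _ _ => norm_nonneg _) fun _ _ => hM _ _)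
    exact (mul_le_mul_of_nonneg_left this (by positivity)).trans hi.le
  have h4 : ‖M.det‖ ≤ ∑ τ : Equiv.Perm (Fin q), ∏ i, ‖M (τ i) i‖ := by
    rw [Matrix.det_apply]
    refine (norm_sum_le _ _).trans (Finset.sum_le_sum fun τ _ => ?_)
    rw [← norm_prod]
    rcases Int.units_eq_one_or (Equiv.Perm.sign τ) with hs | hs <;> simp [hs]
  have h5 : 2 * (q.factorial : ℝ) * ‖M.det‖ ≤ q.factorial := by
    refine (mul_le_mul_of_nonneg_left h4 (by positivity)).trans ?_
    rw [Finset.mul_sum]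
    refine (Finset.sum_le_sum fun τ _ => hprod τ).trans ?_
    simp [Fintype.card_perm]
  have h6 : (0 : ℝ) < q.factorial := by exact_mod_cast q.factorial_pos
  nlinarith

/-- The eigenvalues of ladder bases depend continuously on the operators. -/
theorem exists_perm_eigenvalues (q : ℕ) (hκ : 0 < κ) : ∃ ε₀ > 0,
    ∀ (T T' S S' : 𝒟 →ₗ[ℂ] H) (l l' : Fin q → ℂ) (b c : HilbertBasis (Fin q ⊕ ℕ × ι) ℂ H) (ε : ℝ),
      AdjointPair T T' → AdjointPair S S' → IsLadderBasis T T' κ l b → IsLadderBasis S S' κ l' c →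
      0 ≤ ε → ε ≤ ε₀ → (∀ φ : 𝒟, ‖T' φ - S' φ‖ ≤ ε * ‖(φ : H)‖) →
      ∃ τ : Equiv.Perm (Fin q), ∀ i, ‖l (τ i) - l' i‖ ≤ 2 * q.factorial * ε := by
  classical
  obtain ⟨δ, hδ, hM⟩ := exists_perm_of_almost_isometry q
  -- With this threshold the part `r j` of `c j` outside the eigenspan of `b` satisfies `‖r j‖² ≤
  -- ε²/κ ≤ δ/2`.
  refine ⟨√(κ * δ / 2), Real.sqrt_pos.2 (by positivity), ?_⟩
  intro T T' S S' l l' b c ε hT hS hb hc hε hε₀ hTS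
  have hnb : ∀ j, ‖b j‖ = 1 := b.orthonormal.1
  have hnc : ∀ j, ‖c j‖ = 1 := c.orthonormal.1
  have hy : ∀ j, ∃ y, Maps T' (c (.inl j)) y ∧ ‖y - (-l' j) • c (.inl j)‖ ≤ ε := by
    intro j
    have hcj := hc.right_inl j
    refine ⟨T' ⟨_, hcj.mem⟩, ⟨hcj.mem, rfl⟩, ?_⟩
    have h1 := hTS ⟨_, hcj.mem⟩
    rw [hcj.2] at h1
    simpa [hnc] using h1
  choose y hy hyε using hy
  set M : Matrix (Fin q) (Fin q) ℂ := Matrix.of fun i j => inner ℂ (b (.inl i)) (c (.inl j)) with hMdef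
  set r : Fin q → H := fun j => c (.inl j) - ∑ i, inner ℂ (b (.inl i)) (c (.inl j)) • b (.inl i)
    with hr
  have hr1 : ∀ j, κ * ‖r j‖ ^ 2 ≤ ε ^ 2 := fun j =>
    (hb.norm_sub_sum_sq_le hT hκ.le (hy j) (-l' j)).trans
      (pow_le_pow_left₀ (norm_nonneg _) (hyε j) 2)
  have hr2 : ∀ j, ‖r j‖ ^ 2 ≤ δ / 2 := by
    intro j
    have h1 : ε ^ 2 ≤ κ * δ / 2 := by
      have := pow_le_pow_left₀ hε hε₀ 2
      rwa [Real.sq_sqrt (by positivity)] at this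
    have h2 := (hr1 j).trans h1
    rw [mul_div_assoc] at h2
    exact le_of_mul_le_mul_left h2 hκ
  have hr3 : ∀ j i, inner ℂ (r j) (b (.inl i)) = 0 := fun j i => by
    simp only [hr, inner_sub_left, sum_inner, inner_smul_left, hilbertBasis_inner_eq]
    simp
  -- The Gram matrix of the residuals is the defect `1 - M* M` of the overlap matrix.
  have hr4 : ∀ j k, inner ℂ (r j) (r k) =
      (1 : Matrix (Fin q) (Fin q) ℂ) j k - (M.conjTranspose * M) j k := by
    intro j k
    have : inner ℂ (r j) (r k) = inner ℂ (r j) (c (.inl k)) := by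
      nth_rewrite 2 [hr]
      simp only
      rw [inner_sub_right, inner_sum, Finset.sum_eq_zero, sub_zero]
      intro i _
      rw [inner_smul_right, hr3, mul_zero]
    have hMM : (M.conjTranspose * M) j k = ∑ i, conj (M i j) * M i k := rfl
    rw [this, hMM]
    simp only [hr, inner_sub_left, sum_inner, inner_smul_left, hilbertBasis_inner_eq,
      Matrix.one_apply, hMdef, Matrix.of_apply, Sum.inl.injEq]
  obtain ⟨τ, hτ⟩ := hM M (fun i j => by
      have := norm_inner_le_norm (𝕜 := ℂ) (b (.inl i)) (c (.inl j))
      rwa [hnb, hnc, mul_one] at this) (fun j k => by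
      rw [norm_sub_rev, ← hr4]
      refine (norm_inner_le_norm _ _).trans_lt ?_
      nlinarith [hr2 j, hr2 k, sq_nonneg (‖r j‖ - ‖r k‖)])
  refine ⟨τ, fun i => ?_⟩
  -- Pairing the eigenvalue defect of `c i` with `b (τ i)` isolates the difference of positions
  -- times an overlap, and `τ` was chosen to keep this overlap away from zero.
  have h1 : inner ℂ (b (.inl (τ i))) (y i - (-l' i) • c (.inl i)) =
      -(l (τ i) - l' i) * M (τ i) i := by
    have := hb.inner_right hT (hy i) (.inl (τ i))
    simp only [ladderShift, Sum.map_inl, id, ladderWeight, Sum.elim_inl] at this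
    rw [inner_sub_right, inner_smul_right, this]
    simp only [hMdef, Matrix.of_apply]
    ring
  have h2 : ‖l (τ i) - l' i‖ * ‖M (τ i) i‖ ≤ ε := by
    rw [← norm_neg, ← norm_mul, ← h1]
    refine (norm_inner_le_norm _ _).trans ?_
    rw [hnb, one_mul]
    exact hyε i
  calc ‖l (τ i) - l' i‖ ≤ ‖l (τ i) - l' i‖ * (2 * q.factorial * ‖M (τ i) i‖) :=
        le_mul_of_one_le_right (norm_nonneg _) (hτ i)
    _ = 2 * q.factorial * (‖l (τ i) - l' i‖ * ‖M (τ i) i‖) := by ring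
    _ ≤ 2 * q.factorial * ε := by gcongr

end Ladder
end Fluxon
namespace Fluxon

/-! ### Classification of the solutions of the Yang-Mills equations -/

section Normal

variable {E : Type*} [NormedAddCommGroup E] [InnerProductSpace ℂ E] [FiniteDimensional ℂ E]

/-- A normal operator on a finite-dimensional space has an orthonormal basis of eigenvectors. -/
lemma exists_orthonormalBasis_eigenvectors (A B : E →ₗ[ℂ] E)
    (hadj : ∀ x y, inner ℂ (A x) y = inner ℂ x (B y)) (hcomm : Commute A B) :
    ∃ (q : ℕ) (e : OrthonormalBasis (Fin q) ℂ E) (l : Fin q → ℂ), ∀ i, B (e i) = -l i • e i := by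
  have hadj' : ∀ x y, inner ℂ (B x) y = inner ℂ x (A y) := fun x y => by
    rw [← inner_conj_symm, ← hadj, inner_conj_symm]
  -- `A + B` and `i(A - B)` are commuting symmetric operators, hence simultaneously diagonalisable,
  -- and `B` is a linear combination of them.
  have h1 : (A + B).IsSymmetric := fun x y => by
    simp only [LinearMap.add_apply, inner_add_left, inner_add_right, hadj, hadj']
    ring
  have h2 : (Complex.I • (A - B)).IsSymmetric := fun x y => by
    simp only [LinearMap.smul_apply, LinearMap.sub_apply, inner_sub_left, inner_sub_right, hadj,
      hadj', inner_smul_left, inner_smul_right, Complex.conj_I]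
    ring
  have h3 : Commute (A + B) (Complex.I • (A - B)) := by
    refine Commute.smul_right ?_ _
    exact ((Commute.refl A).sub_right hcomm).add_left (hcomm.symm.sub_right (Commute.refl B))
  classical
  have hV := LinearMap.IsSymmetric.directSum_isInternal_of_commute h1 h2 h3
  have hO := LinearMap.IsSymmetric.orthogonalFamily_eigenspace_inf_eigenspace h1 h2
  have hex : ∀ v : E, ∀ i : ℂ × ℂ,
      v ∈ Module.End.eigenspace (A + B) i.2 ⊓ Module.End.eigenspace (Complex.I • (A - B)) i.1 →
      B v = ((i.2 + Complex.I * i.1) / 2) • v := by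
    rintro v i ⟨ha, hb⟩
    have ha' := Module.End.mem_eigenspace_iff.1 ha
    have hb' := Module.End.mem_eigenspace_iff.1 hb
    simp only [LinearMap.add_apply] at ha'
    simp only [LinearMap.smul_apply, LinearMap.sub_apply] at hb'
    have hb2 : A v - B v = (-Complex.I * i.1) • v := by
      rw [mul_smul, ← hb', smul_smul]
      simp
    have hB : B v = (2⁻¹ : ℂ) • ((A v + B v) - (A v - B v)) := by
      rw [add_sub_sub_cancel, ← two_smul ℂ (B v), smul_smul]
      norm_num
    rw [hB, ha', hb2, ← sub_smul, smul_smul]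
    congr 1
    ring
  -- A subordinate orthonormal basis needs a finite index set, so the zero joint eigenspaces are
  -- discarded.
  have hfin := WellFoundedGT.finite_ne_bot_of_iSupIndep hV.submodule_iSupIndep
  have : Fintype {i : ℂ × ℂ // Module.End.eigenspace (A + B) i.2 ⊓
      Module.End.eigenspace (Complex.I • (A - B)) i.1 ≠ ⊥} := hfin.fintype
  have hV' := DirectSum.isInternal_ne_bot_iff.2 hV
  have hO' := hO.comp (Subtype.val_injective (p := fun i : ℂ × ℂ =>
    Module.End.eigenspace (A + B) i.2 ⊓ Module.End.eigenspace (Complex.I • (A - B)) i.1 ≠ ⊥))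
  refine ⟨_, hV'.subordinateOrthonormalBasis rfl hO',
    fun a => -(((hV'.subordinateOrthonormalBasisIndex rfl a hO').1.2 +
      Complex.I * (hV'.subordinateOrthonormalBasisIndex rfl a hO').1.1) / 2), fun a => ?_⟩
  rw [neg_neg]
  exact hex _ _ (hV'.subordinateOrthonormalBasis_subordinate rfl a hO')

end Normal

/-! ### Abstract Yang-Mills systems. -/

section System

variable {H : Type*} [NormedAddCommGroup H] [InnerProductSpace ℂ H] {𝒟 : Submodule ℂ H}

/-- A solution of the Yang-Mills equations in abstract form: `G` is the bounded operator
`[T', T] + κ`, it commutes with `T` and `T'`, its eigenspaces for nonzero eigenvalues are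
finite-dimensional, and `K = (1 + T' T)⁻¹` is compact. -/
structure IsYangMillsSystem (T T' : 𝒟 →ₗ[ℂ] H) (κ : ℝ) (G K : H →L[ℂ] H) : Prop where
  adj : AdjointPair T T'
  pos : 0 < κ
  form : ∀ φ ψ : 𝒟, inner ℂ (φ : H) (G ψ) =
    inner ℂ (T φ) (T ψ) - inner ℂ (T' φ) (T' ψ) + κ * inner ℂ (φ : H) (ψ : H)
  comm_left : ∀ {x y : H}, Maps T x y → Maps T (G x) (G y)
  comm_right : ∀ {x y : H}, Maps T' x y → Maps T' (G x) (G y)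
  compact : IsCompactOperator K
  resolvent : ∀ x : H, ∃ y, Maps T (K x) y ∧ Maps T' y (x - K x)
  finite : ∀ g : ℂ, g ≠ 0 → FiniteDimensional ℂ (Module.End.eigenspace (G : H →ₗ[ℂ] H) g)

/-- `x` is an eigenvector of `T' T` with eigenvalue `ν` in the kernel of `G`. -/
def IsLevel (T T' : 𝒟 →ₗ[ℂ] H) (G : H →L[ℂ] H) (ν : ℂ) (x : H) : Prop :=
  G x = 0 ∧ ∃ y, Maps T x y ∧ Maps T' y (ν • x)

namespace IsYangMillsSystem

variable {T T' : 𝒟 →ₗ[ℂ] H} {κ : ℝ} {G K : H →L[ℂ] H} {x y z : H} {μ ν : ℂ}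

/-- The defining form is Hermitian on `𝒟`; density of `𝒟` extends the symmetry of the bounded `G`
one argument at a time. -/
lemma symm_G [CompleteSpace H] (h : IsYangMillsSystem T T' κ G K) (x y : H) :
    inner ℂ (G x) y = inner ℂ x (G y) := by
  have h1 : ∀ φ ψ : 𝒟, inner ℂ (G φ) (ψ : H) = inner ℂ (φ : H) (G ψ) := by
    intro φ ψ
    rw [← inner_conj_symm, h.form, h.form]
    simp only [map_add, map_sub, map_mul, inner_conj_symm, Complex.conj_ofReal]
  have h2 : ∀ φ : 𝒟, ContinuousLinearMap.adjoint G φ = G φ := fun φ =>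
    h.adj.eq_of_inner fun ψ => by
      rw [ContinuousLinearMap.adjoint_inner_right, h1]
  have h3 : ContinuousLinearMap.adjoint G y = G y := h.adj.eq_of_inner fun ψ => by
    rw [ContinuousLinearMap.adjoint_inner_right, ← h2, ContinuousLinearMap.adjoint_inner_left]
  rw [← h3, ContinuousLinearMap.adjoint_inner_right]

lemma symm_K (h : IsYangMillsSystem T T' κ G K) (x y : H) :
    inner ℂ (K x) y = inner ℂ x (K y) := by
  obtain ⟨u, hu, hu'⟩ := h.resolvent x
  obtain ⟨v, hv, hv'⟩ := h.resolvent y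
  have h1 := h.adj.inner_eq hu hv'
  have h2 := h.adj.inner_eq' hv hu'
  rw [inner_sub_right] at h1
  rw [inner_sub_left, h1] at h2
  linear_combination -h2

/-- `1 + T'T` is injective: the difference `d` of two solutions satisfies `T'T d = -d`, so `‖T d‖² =
-‖d‖²`. -/
lemma eq_K (h : IsYangMillsSystem T T' κ G K) (h1 : Maps T x y) (h2 : Maps T' y (z - x)) :
    x = K z := by
  obtain ⟨u, hu, hu'⟩ := h.resolvent z
  have h3 := h1.sub hu
  have h4 := h2.sub hu'
  have h5 := h.adj.inner_eq h3 h4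
  rw [show z - x - (z - K z) = -(x - K z) by abel, inner_neg_right, inner_self_eq_norm_sq_to_K,
    inner_self_eq_norm_sq_to_K] at h5
  have h6 : ‖y - u‖ ^ 2 = -‖x - K z‖ ^ 2 := by exact_mod_cast h5
  have h7 : ‖x - K z‖ = 0 := by nlinarith [sq_nonneg ‖y - u‖, sq_nonneg ‖x - K z‖]
  exact sub_eq_zero.1 (norm_eq_zero.1 h7)

lemma K_eq_zero (h : IsYangMillsSystem T T' κ G K) (hx : K x = 0) : x = 0 := by
  obtain ⟨u, hu, hu'⟩ := h.resolvent x
  rw [hx] at hu hu'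
  rw [hu.unique Maps.zero, sub_zero] at hu'
  exact hu'.unique Maps.zero

lemma comm_K (h : IsYangMillsSystem T T' κ G K) (x : H) : K (G x) = G (K x) := by
  obtain ⟨u, hu, hu'⟩ := h.resolvent x
  exact (h.eq_K (h.comm_left hu) (by rw [← map_sub]; exact h.comm_right hu')).symm

/-! #### Eigenspaces of the curvature -/

/-- `K` commutes with `G` and is injective, hence it is surjective on this finite-dimensional
eigenspace. The range of `K` lies in the domain. -/
lemma eigenspace_le (h : IsYangMillsSystem T T' κ G K) {g : ℂ} (hg : g ≠ 0) :
    Module.End.eigenspace (G : H →ₗ[ℂ] H) g ≤ 𝒟 := by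
  intro x hx
  have := h.finite g hg
  have hinv : ∀ z ∈ Module.End.eigenspace (G : H →ₗ[ℂ] H) g,
      (K : H →ₗ[ℂ] H) z ∈ Module.End.eigenspace (G : H →ₗ[ℂ] H) g := by
    intro z hz
    rw [Module.End.mem_eigenspace_iff] at hz ⊢
    change G (K z) = g • K z
    change G z = g • z at hz
    rw [← h.comm_K, hz, map_smul]
  have hinj : Function.Injective ((K : H →ₗ[ℂ] H).restrict hinv) := by
    rw [injective_iff_map_eq_zero]
    intro z hz
    exact Subtype.ext (h.K_eq_zero (congrArg Subtype.val hz))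
  obtain ⟨z, hz⟩ := LinearMap.injective_iff_surjective.1 hinj ⟨x, hx⟩
  have hzx : K z = x := congrArg Subtype.val hz
  obtain ⟨u, hu, -⟩ := h.resolvent z
  exact hzx ▸ hu.mem

lemma map_eigenspace {S : 𝒟 →ₗ[ℂ] H} (hS : ∀ {x y : H}, Maps S x y → Maps S (G x) (G y)) {g : ℂ}
    (hx : x ∈ Module.End.eigenspace (G : H →ₗ[ℂ] H) g) (hy : Maps S x y) :
    y ∈ Module.End.eigenspace (G : H →ₗ[ℂ] H) g := by
  rw [Module.End.mem_eigenspace_iff] at hx ⊢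
  change G x = g • x at hx
  have := hS hy
  rw [hx] at this
  exact this.unique (hy.smul g)

lemma exists_eigenspace_operator {S : 𝒟 →ₗ[ℂ] H}
    (hS : ∀ {x y : H}, Maps S x y → Maps S (G x) (G y)) {g : ℂ}
    (hle : Module.End.eigenspace (G : H →ₗ[ℂ] H) g ≤ 𝒟) :
    ∃ A : Module.End.eigenspace (G : H →ₗ[ℂ] H) g →ₗ[ℂ] Module.End.eigenspace (G : H →ₗ[ℂ] H) g,
      ∀ x : Module.End.eigenspace (G : H →ₗ[ℂ] H) g, Maps S (x : H) (A x : H) :=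
  ⟨(S ∘ₗ Submodule.inclusion hle).codRestrict _ fun x =>
      map_eigenspace hS x.2 (Maps.of_coe (T := S) (Submodule.inclusion hle x)),
    fun x : Module.End.eigenspace (G : H →ₗ[ℂ] H) g => Maps.of_coe (Submodule.inclusion hle x)⟩

lemma commutator_eq (h : IsYangMillsSystem T T' κ G K) {y' z' : H} (hy : Maps T x y)
    (hy' : Maps T' x y') (hz : Maps T' y z) (hz' : Maps T y' z') : z - z' + (κ : ℂ) • x = G x := by
  refine h.adj.eq_of_inner fun φ => ?_
  have h1 := h.form φ ⟨x, hy.mem⟩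
  rw [hy.2, hy'.2, h.adj.maps_left.1 hz', h.adj.maps_right.1 hz] at h1
  rw [h1, inner_add_right, inner_sub_right, inner_smul_right]

/-- On the finite-dimensional eigenspace the scalar `g - κ` is a commutator, so its trace vanishes.
-/
lemma eigenvalue_eq (h : IsYangMillsSystem T T' κ G K) {g : ℂ} (hg : g ≠ 0) (hx0 : x ≠ 0)
    (hx : G x = g • x) : g = κ := by
  have := h.finite g hg
  obtain ⟨A, hA⟩ := exists_eigenspace_operator h.comm_left (h.eigenspace_le hg)
  obtain ⟨B, hB⟩ := exists_eigenspace_operator h.comm_right (h.eigenspace_le hg)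
  have h1 : B * A - A * B = (g - κ) • (1 : Module.End ℂ _) := by
    ext v
    have h2 := h.commutator_eq (hA v) (hB v) (hB (A v)) (hA (B v))
    have h3 : G (v : H) = g • (v : H) := Module.End.mem_eigenspace_iff.1 v.2
    rw [h3] at h2
    change (B (A v) : H) - (A (B v) : H) = (g - κ) • (v : H)
    rw [sub_smul, ← h2]
    abel
  have h2 := congrArg (LinearMap.trace ℂ _) h1
  rw [map_sub, LinearMap.trace_mul_comm, sub_self, map_smul, LinearMap.trace_one, smul_eq_mul] at h2
  have h3 : Nontrivial (Module.End.eigenspace (G : H →ₗ[ℂ] H) g) :=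
    ⟨⟨⟨x, Module.End.mem_eigenspace_iff.2 hx⟩, 0, fun h0 => hx0 (congrArg Subtype.val h0)⟩⟩
  have h4 : (Module.finrank ℂ (Module.End.eigenspace (G : H →ₗ[ℂ] H) g) : ℂ) ≠ 0 := by
    exact_mod_cast Module.finrank_pos.ne'
  exact sub_eq_zero.1 ((mul_eq_zero.1 h2.symm).resolve_right h4)

/-- For `g = κ` the commutator vanishes, so `T` and `T'` restrict to a normal matrix and its
adjoint. -/
lemma exists_eigenvectors (h : IsYangMillsSystem T T' κ G K) :
    ∃ (q : ℕ) (e : Fin q → H) (l : Fin q → ℂ), Orthonormal ℂ e ∧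
      (∀ i, Maps T' (e i) (-l i • e i) ∧ Maps T (e i) (-conj (l i) • e i) ∧
        G (e i) = (κ : ℂ) • e i) ∧
      ∀ x, G x = (κ : ℂ) • x → x ∈ Submodule.span ℂ (Set.range e) := by
  have hκ : (κ : ℂ) ≠ 0 := by exact_mod_cast h.pos.ne'
  have := h.finite κ hκ
  obtain ⟨A, hA⟩ := exists_eigenspace_operator h.comm_left (h.eigenspace_le hκ)
  obtain ⟨B, hB⟩ := exists_eigenspace_operator h.comm_right (h.eigenspace_le hκ)
  have hadj : ∀ x y, inner ℂ (A x) y = inner ℂ x (B y) := fun x y => h.adj.inner_eq (hA x) (hB y)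
  have hcomm : Commute A B := by
    ext v
    have h2 := h.commutator_eq (hA v) (hB v) (hB (A v)) (hA (B v))
    have h3 : G (v : H) = (κ : ℂ) • (v : H) := Module.End.mem_eigenspace_iff.1 v.2
    rw [h3, add_eq_right, sub_eq_zero] at h2
    exact h2.symm
  obtain ⟨q, e, l, hl⟩ := exists_orthonormalBasis_eigenvectors A B hadj hcomm
  refine ⟨q, fun i => e i, l, ?_, fun i => ?_, fun x hx => ?_⟩
  · exact e.orthonormal.comp_linearIsometry (Submodule.subtypeₗᵢ _)
  · have hA' : A (e i) = -conj (l i) • e i := by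
      refine hilbertBasis_ext e.toHilbertBasis fun j => ?_
      rw [e.coe_toHilbertBasis, ← inner_conj_symm, hadj, hl, inner_smul_right, map_mul,
        inner_conj_symm, inner_smul_right, map_neg, orthonormal_iff_ite.1 e.orthonormal]
      split_ifs with hij
      · rw [hij]
      · simp
    refine ⟨?_, ?_, Module.End.mem_eigenspace_iff.1 (e i).2⟩
    · have := hB (e i)
      rwa [hl] at this
    · have := hA (e i)
      rwa [hA'] at this
  · have h1 := e.sum_repr ⟨x, Module.End.mem_eigenspace_iff.2 hx⟩
    have h2 : x = ∑ i, e.repr ⟨x, Module.End.mem_eigenspace_iff.2 hx⟩ i • (e i : H) := by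
      have := congrArg Subtype.val h1
      simpa using this.symm
    rw [h2]
    exact Submodule.sum_mem _ fun i _ => Submodule.smul_mem _ _ (Submodule.subset_span ⟨i, rfl⟩)

/-! #### Levels -/

/-- On the kernel of `G` one has `TT' - T'T = κ`, so `T` lowers eigenvalues of `T'T` by `κ`, and
`T'` raises them in `isLevel_right`. -/
lemma isLevel_left (h : IsYangMillsSystem T T' κ G K) (hx : IsLevel T T' G ν x) (hy : Maps T x y) :
    IsLevel T T' G (ν - κ) y := by
  obtain ⟨h0, y', hy1, hy2⟩ := hx
  obtain rfl := hy1.unique hy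
  have hG : G y' = 0 := by
    have := h.comm_left hy1
    rw [h0] at this
    exact this.unique Maps.zero
  -- `y'` is in the domain because `T'` is defined on it; that `T y'` is in the domain again follows
  -- from the form identity and exact adjointness.
  refine ⟨hG, T ⟨y', hy2.mem⟩, ⟨hy2.mem, rfl⟩, h.adj.maps_right.2 fun φ => ?_⟩
  have h1 := h.form φ ⟨y', hy2.mem⟩
  rw [hG, hy2.2, inner_zero_right, inner_smul_right, h.adj.maps_left.1 hy1] at h1
  rw [inner_smul_right]
  linear_combination -h1

lemma isLevel_right (h : IsYangMillsSystem T T' κ G K) (hx : IsLevel T T' G ν x)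
    (hy : Maps T' x y) : Maps T y ((ν + κ) • x) ∧ IsLevel T T' G (ν + κ) y := by
  obtain ⟨h0, y', hy1, hy2⟩ := hx
  have hG : G y = 0 := by
    have := h.comm_right hy
    rw [h0] at this
    exact this.unique Maps.zero
  have h1 : Maps T y ((ν + κ) • x) := h.adj.maps_left.2 fun φ => by
    have h1 := h.form φ ⟨x, hy1.mem⟩
    rw [h0, hy1.2, hy.2, inner_zero_right, h.adj.maps_right.1 hy2, inner_smul_right] at h1
    rw [inner_smul_right]
    linear_combination h1
  exact ⟨h1, hG, _, h1, hy.smul _⟩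

lemma norm_sq_level (h : IsYangMillsSystem T T' κ G K) (hy : Maps T x y)
    (hy' : Maps T' y (ν • x)) : ((‖y‖ ^ 2 : ℝ) : ℂ) = ν * ((‖x‖ ^ 2 : ℝ) : ℂ) := by
  have h1 := h.adj.inner_eq hy hy'
  rw [inner_smul_right, inner_self_eq_norm_sq_to_K, inner_self_eq_norm_sq_to_K] at h1
  push_cast
  exact h1

/-- Since `‖T x‖² = ν‖x‖²`, an eigenvalue cannot have negative real part. Lowering by `κ` must
therefore stop, which it does only where `T x = 0`, that is at `ν = 0`. -/
lemma level_eq_natCast_mul (h : IsYangMillsSystem T T' κ G K) (hx : IsLevel T T' G ν x)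
    (hx0 : x ≠ 0) : ∃ n : ℕ, ν = n * κ := by
  have key : ∀ m : ℕ, ∀ ν x, ν.re < m * κ → IsLevel T T' G ν x → x ≠ 0 → ∃ n : ℕ, ν = n * κ := by
    intro m
    induction m with
    | zero =>
      rintro ν x hν ⟨-, y, hy, hy'⟩ hx0
      have h1 := congrArg Complex.re (h.norm_sq_level hy hy')
      rw [Complex.ofReal_re, Complex.re_mul_ofReal] at h1
      have h2 : 0 < ‖x‖ ^ 2 := by positivity
      simp only [Nat.cast_zero, zero_mul] at hν
      nlinarith [sq_nonneg ‖y‖]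
    | succ m ih =>
      intro ν x hν hx hx0
      obtain ⟨-, y, hy, hy'⟩ := id hx
      by_cases hy0 : y = 0
      · refine ⟨0, ?_⟩
        rw [hy0] at hy'
        have := hy'.unique Maps.zero
        simpa [hx0] using this
      · obtain ⟨n, hn⟩ := ih (ν - κ) y (by
          push_cast at hν
          simp only [Complex.sub_re, Complex.ofReal_re]
          linarith) (h.isLevel_left hx hy) hy0
        exact ⟨n + 1, by push_cast; linear_combination hn⟩
  obtain ⟨m, hm⟩ := exists_nat_gt (ν.re / κ)
  rw [div_lt_iff₀ h.pos] at hm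
  exact key m ν x hm hx hx0

lemma inner_level_eq_zero (h : IsYangMillsSystem T T' κ G K) {r s : ℝ} (hrs : r ≠ s)
    (hx : IsLevel T T' G r x) (hz : IsLevel T T' G s z) : inner ℂ x z = 0 := by
  obtain ⟨-, y, hy, hy'⟩ := hx
  obtain ⟨-, w, hw, hw'⟩ := hz
  have h1 := h.adj.inner_eq hy hw'
  have h2 := h.adj.inner_eq' hw hy'
  rw [inner_smul_right] at h1
  rw [inner_smul_left, Complex.conj_ofReal, h1] at h2
  have h3 : ((r : ℂ) - s) * inner ℂ x z = 0 := by linear_combination h2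
  refine (mul_eq_zero.1 h3).resolve_left ?_
  exact sub_ne_zero.2 (by exact_mod_cast hrs)

lemma K_of_isLevel (h : IsYangMillsSystem T T' κ G K) (hx : IsLevel T T' G ν x) :
    (1 + ν) • K x = x := by
  obtain ⟨-, y, hy, hy'⟩ := hx
  rw [← map_smul]
  refine (h.eq_K hy ?_).symm
  rwa [add_smul, one_smul, add_sub_cancel_left]

lemma isLevel_of_K (h : IsYangMillsSystem T T' κ G K) (hx : G x = 0) (hμ : μ ≠ 0)
    (hK : K x = μ • x) : IsLevel T T' G (μ⁻¹ - 1) x := by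
  obtain ⟨y, hy, hy'⟩ := h.resolvent x
  rw [hK] at hy hy'
  refine ⟨hx, μ⁻¹ • y, ?_, ?_⟩
  · have := hy.smul μ⁻¹
    rwa [smul_smul, inv_mul_cancel₀ hμ, one_smul] at this
  · have := hy'.smul μ⁻¹
    rwa [smul_sub, smul_smul, inv_mul_cancel₀ hμ, ← sub_smul] at this

end IsYangMillsSystem
end System
end Fluxon
namespace Fluxon

section System

variable {H : Type*} [NormedAddCommGroup H] [InnerProductSpace ℂ H] {𝒟 : Submodule ℂ H}

namespace IsYangMillsSystem

variable {T T' : 𝒟 →ₗ[ℂ] H} {κ : ℝ} {G K : H →L[ℂ] H} {x y z : H} {μ ν : ℂ}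

/-! #### The ladder over the vacua -/

/-- Vacua are fixed by `K`, and the eigenspace of a compact operator for the eigenvalue `1` is
finite-dimensional. -/
lemma exists_vacua [CompleteSpace H] (h : IsYangMillsSystem T T' κ G K) :
    ∃ (m : ℕ) (e : Fin m → H), Orthonormal ℂ e ∧ (∀ k, IsLevel T T' G (0 : ℂ) (e k)) ∧
      ∀ x, IsLevel T T' G (0 : ℂ) x → x ∈ Submodule.span ℂ (Set.range e) := by
  let V : Submodule ℂ H :=
    { carrier := {x | G x = 0 ∧ Maps T x 0}
      zero_mem' := ⟨map_zero G, Maps.zero⟩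
      add_mem' := fun {a b} ha hb => ⟨by rw [map_add, ha.1, hb.1, add_zero], by
        simpa using ha.2.add hb.2⟩
      smul_mem' := fun c a ha => ⟨by rw [map_smul, ha.1, smul_zero], by
        simpa using ha.2.smul c⟩ }
  have hV1 : ∀ x, x ∈ V → IsLevel T T' G (0 : ℂ) x := fun x hx =>
    ⟨hx.1, 0, hx.2, by rw [zero_smul]; exact Maps.zero⟩
  have hV2 : ∀ x, IsLevel T T' G (0 : ℂ) x → x ∈ V := by
    rintro x ⟨h0, y, hy, hy'⟩
    have h1 := h.norm_sq_level hy hy'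
    rw [zero_mul] at h1
    have h2 : y = 0 := by
      have : ‖y‖ ^ 2 = 0 := by exact_mod_cast h1
      simpa using this
    exact ⟨h0, h2 ▸ hy⟩
  have hle : V ≤ Module.End.eigenspace (K : H →ₗ[ℂ] H) 1 := fun x hx => by
    have := h.K_of_isLevel (hV1 x hx)
    rw [add_zero, one_smul] at this
    rw [Module.End.mem_eigenspace_iff, one_smul]
    exact this
  have hfin := ContinuousLinearMap.finite_dimensional_eigenspace h.compact 1 one_ne_zero
  have : FiniteDimensional ℂ V := Submodule.finiteDimensional_of_le hle
  refine ⟨_, fun k => stdOrthonormalBasis ℂ V k, ?_, fun k => hV1 _ (Subtype.prop _), fun x hx => ?_⟩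
  · exact (stdOrthonormalBasis ℂ V).orthonormal.comp_linearIsometry (Submodule.subtypeₗᵢ _)
  · have h1 := (stdOrthonormalBasis ℂ V).sum_repr ⟨x, hV2 x hx⟩
    have h2 := congrArg Subtype.val h1
    simp only [AddSubmonoidClass.coe_finsetSum, Submodule.coe_smul] at h2
    rw [← h2]
    exact Submodule.sum_mem _ fun i _ => Submodule.smul_mem _ _ (Submodule.subset_span ⟨i, rfl⟩)

/-- The vectors are the normalised iterates of `T'` on the vacua. Inner products within a level
carry over to the next by adjointness, and distinct levels are orthogonal as eigenspaces of `T'T`.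
-/
lemma exists_ladder [CompleteSpace H] (h : IsYangMillsSystem T T' κ G K) :
    ∃ (m : ℕ) (f : ℕ × Fin m → H), Orthonormal ℂ f ∧ (∀ p, G (f p) = 0) ∧
      (∀ k, Maps T (f (0, k)) 0) ∧
      (∀ n k, Maps T' (f (n, k)) (((√((n + 1 : ℝ) * κ) : ℝ) : ℂ) • f (n + 1, k)) ∧
        Maps T (f (n + 1, k)) (((√((n + 1 : ℝ) * κ) : ℝ) : ℂ) • f (n, k))) ∧
      ∀ n : ℕ, ∀ x, IsLevel T T' G (n * κ) x →
        x ∈ Submodule.span ℂ (Set.range fun k => f (n, k)) := by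
  classical
  obtain ⟨m, e, he1, he2, he3⟩ := h.exists_vacua
  set c : ℕ → ℂ := fun n => ((√((n + 1 : ℝ) * κ) : ℝ) : ℂ) with hc
  have hc0 : ∀ n, c n ≠ 0 := fun n => by
    have := h.pos
    have h1 : √((n + 1 : ℝ) * κ) ≠ 0 := by positivity
    simpa only [hc, ne_eq, Complex.ofReal_eq_zero] using h1
  have hcc : ∀ n, c n * c n = n * κ + κ := fun n => by
    have := h.pos
    rw [hc]
    simp only
    rw [← Complex.ofReal_mul, Real.mul_self_sqrt (by positivity)]
    push_cast
    ring
  have hconj : ∀ n, conj (c n) = c n := fun n => Complex.conj_ofReal _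
  -- The value `0` off the domain is never used: every iterate is shown to lie in `𝒟`.
  let ext : H → H := fun x => if hx : x ∈ 𝒟 then T' ⟨x, hx⟩ else 0
  have hext : ∀ x, x ∈ 𝒟 → Maps T' x (ext x) := fun x hx => ⟨hx, by simp only [ext, dif_pos hx]⟩
  obtain ⟨f, hf0, hfs⟩ : ∃ f : ℕ → Fin m → H, (∀ k, f 0 k = e k) ∧
      ∀ n k, f (n + 1) k = (c n)⁻¹ • ext (f n k) :=
    ⟨fun n k => Nat.rec (e k) (fun n x => (c n)⁻¹ • ext x) n, fun _ => rfl, fun _ _ => rfl⟩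
  have hlev : ∀ (n : ℕ) k, IsLevel T T' G (n * κ) (f n k) := by
    intro n k
    induction n with
    | zero => simpa [hf0] using he2 k
    | succ n ih =>
      obtain ⟨-, y, hy, -⟩ := id ih
      have h1 := (h.isLevel_right ih ((hext _ hy.mem))).2
      obtain ⟨h2, w, hw, hw'⟩ := h1
      rw [hfs]
      refine ⟨by rw [map_smul, h2, smul_zero], _, hw.smul _, ?_⟩
      rw [smul_comm]
      have := hw'.smul (c n)⁻¹
      rwa [show ((n : ℂ) * κ + κ) = ((n + 1 : ℕ) : ℂ) * κ by push_cast; ring] at this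
  have hmem : ∀ n k, f n k ∈ 𝒟 := fun n k => by
    obtain ⟨-, y, hy, -⟩ := hlev n k
    exact hy.mem
  have hr : ∀ n k, Maps T' (f n k) (c n • f (n + 1) k) := fun n k => by
    rw [hfs, smul_smul, mul_inv_cancel₀ (hc0 n), one_smul]
    exact hext _ (hmem n k)
  have hl : ∀ n k, Maps T (f (n + 1) k) (c n • f n k) := fun n k => by
    have h1 := ((h.isLevel_right (hlev n k) (hr n k)).1).smul (c n)⁻¹
    rw [smul_smul, inv_mul_cancel₀ (hc0 n), one_smul, smul_smul, ← hcc, ← mul_assoc,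
      inv_mul_cancel₀ (hc0 n), one_mul] at h1
    exact h1
  have hl0 : ∀ k, Maps T (f 0 k) 0 := fun k => by
    obtain ⟨-, y, hy, hy'⟩ := hlev 0 k
    have h1 := h.norm_sq_level hy hy'
    rw [Nat.cast_zero, zero_mul, zero_mul] at h1
    have h2 : y = 0 := by
      have : ‖y‖ ^ 2 = 0 := by exact_mod_cast h1
      simpa using this
    exact h2 ▸ hy
  have hinner : ∀ n k k', inner ℂ (f n k) (f n k') = if k = k' then (1 : ℂ) else 0 := by
    intro n k k'
    induction n with
    | zero =>
      rw [hf0, hf0]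
      exact orthonormal_iff_ite.1 he1 k k'
    | succ n ih =>
      have h1 := h.adj.inner_eq' (hl n k') (hr n k)
      rw [inner_smul_left, inner_smul_right, hconj, ih] at h1
      exact mul_left_cancel₀ (hc0 n) h1
  refine ⟨m, fun p => f p.1 p.2, ?_, fun p => (hlev p.1 p.2).1, hl0, fun n k => ⟨hr n k, hl n k⟩, ?_⟩
  · rw [orthonormal_iff_ite]
    rintro ⟨n, k⟩ ⟨n', k'⟩
    by_cases hn : n = n'
    · subst hn
      simp [hinner]
    · rw [if_neg (by simp [hn])]
      refine h.inner_level_eq_zero (r := n * κ) (s := n' * κ) ?_ (by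
        push_cast
        exact hlev n k) (by
        push_cast
        exact hlev n' k')
      intro h2
      exact hn (by exact_mod_cast mul_right_cancel₀ h.pos.ne' h2)
  -- A vector `x` of level `n+1` is recovered from `T x`, of level `n`, because `T'(T x) = (n+1)κ x`
  -- with nonzero factor.
  · intro n
    induction n with
    | zero =>
      intro x hx
      simp only [hf0]
      exact he3 x (by simpa using hx)
    | succ n ih =>
      intro x hx
      obtain ⟨-, y, hy, hy'⟩ := id hx
      have h1 := h.isLevel_left hx hy
      rw [show ((n + 1 : ℕ) : ℂ) * κ - κ = n * κ by push_cast; ring] at h1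
      obtain ⟨a, ha⟩ := (Submodule.mem_span_range_iff_exists_fun ℂ).1 (ih y h1)
      have h2 : Maps T' y (∑ k, a k • (c n • f (n + 1) k)) := by
        rw [← ha]
        exact Maps.sum _ fun k _ => (hr n k).smul _
      have h3 := hy'.unique h2
      have h4 : ((n + 1 : ℕ) : ℂ) * κ ≠ 0 :=
        mul_ne_zero (by exact_mod_cast n.succ_ne_zero) (by exact_mod_cast h.pos.ne')
      rw [← Submodule.smul_mem_iff _ h4, h3]
      exact Submodule.sum_mem _ fun k _ => Submodule.smul_mem _ _
        (Submodule.smul_mem _ _ (Submodule.subset_span ⟨k, rfl⟩))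

/-- The compact symmetric injective `K` has a dense span of eigenspaces for nonzero eigenvalues.
Each of these is finite-dimensional and invariant under the symmetric `G`, which is diagonalised
there. -/
lemma eq_zero_of_forall_joint_eigenvector [CompleteSpace H] (h : IsYangMillsSystem T T' κ G K)
    (hx : ∀ (μ g : ℂ) (v : H), v ≠ 0 → K v = μ • v → G v = g • v → inner ℂ v x = 0) : x = 0 := by
  have hperp : x ∈ (⨆ μ, Module.End.eigenspace (K : H →ₗ[ℂ] H) μ)ᗮ := by
    rw [← Submodule.iInf_orthogonal, Submodule.mem_iInf]
    intro μ
    rw [Submodule.mem_orthogonal]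
    intro v hv
    by_cases hμ : μ = 0
    · have : K v = 0 := by
        rw [hμ, Module.End.mem_eigenspace_iff, zero_smul] at hv
        exact hv
      rw [h.K_eq_zero this, inner_zero_left]
    · have := ContinuousLinearMap.finite_dimensional_eigenspace h.compact μ hμ
      have hinv : ∀ z ∈ Module.End.eigenspace (K : H →ₗ[ℂ] H) μ,
          (G : H →ₗ[ℂ] H) z ∈ Module.End.eigenspace (K : H →ₗ[ℂ] H) μ := by
        intro z hz
        rw [Module.End.mem_eigenspace_iff] at hz ⊢
        change K (G z) = μ • G z
        change K z = μ • z at hz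
        rw [h.comm_K, hz, map_smul]
      have hsymm : ((G : H →ₗ[ℂ] H).restrict hinv).IsSymmetric :=
        fun y z => h.symm_G (y : H) (z : H)
      have htop := Submodule.orthogonal_eq_bot_iff.1 hsymm.orthogonalComplement_iSup_eigenspaces_eq_bot
      have hmem : (⟨v, hv⟩ : Module.End.eigenspace (K : H →ₗ[ℂ] H) μ) ∈
          ⨆ g, Module.End.eigenspace ((G : H →ₗ[ℂ] H).restrict hinv) g := by
        rw [htop]
        exact Submodule.mem_top
      refine Submodule.iSup_induction _
        (motive := fun w : Module.End.eigenspace (K : H →ₗ[ℂ] H) μ => inner ℂ (w : H) x = 0) hmem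
        (fun g w hw => ?_) (inner_zero_left _) fun w w' hw hw' => ?_
      · by_cases hw0 : (w : H) = 0
        · rw [hw0, inner_zero_left]
        · exact hx μ g w hw0 (Module.End.mem_eigenspace_iff.1 w.2)
            (congrArg Subtype.val (Module.End.mem_eigenspace_iff.1 hw))
      · rw [Submodule.coe_add, inner_add_left, hw, hw', add_zero]
  have := ContinuousLinearMap.orthogonalComplement_iSup_eigenspaces_eq_bot h.compact
    (fun x y => h.symm_K x y)
  rw [this] at hperp
  exact hperp

/-- Every solution of the Yang-Mills equations has a ladder basis. -/
theorem exists_ladderBasis [CompleteSpace H] (h : IsYangMillsSystem T T' κ G K) :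
    ∃ (q m : ℕ) (l : Fin q → ℂ) (b : HilbertBasis (Fin q ⊕ ℕ × Fin m) ℂ H),
      IsLadderBasis T T' κ l b ∧ (∀ i, G (b (.inl i)) = (κ : ℂ) • b (.inl i)) ∧
        ∀ p, G (b (.inr p)) = 0 := by
  classical
  obtain ⟨q, e, l, he1, he2, he3⟩ := h.exists_eigenvectors
  obtain ⟨m, f, hf1, hf2, hf3, hf4, hf5⟩ := h.exists_ladder
  have hκ : (κ : ℂ) ≠ 0 := by exact_mod_cast h.pos.ne'
  have hef : ∀ i p, inner ℂ (e i) (f p) = 0 := fun i p => by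
    have h1 := h.symm_G (e i) (f p)
    rw [(he2 i).2.2, hf2, inner_zero_right, inner_smul_left, Complex.conj_ofReal] at h1
    exact (mul_eq_zero.1 h1).resolve_left hκ
  have hv : Orthonormal ℂ (Sum.elim e f) := by
    rw [orthonormal_iff_ite]
    rintro (i | p) (j | p')
    · simp [orthonormal_iff_ite.1 he1 i j]
    · simp [hef]
    · simp [inner_eq_zero_symm.1 (hef j p)]
    · simp [orthonormal_iff_ite.1 hf1 p p']
  have hperp : (Submodule.span ℂ (Set.range (Sum.elim e f)))ᗮ = ⊥ := by
    rw [Submodule.eq_bot_iff]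
    intro x hx
    have hx1 : ∀ v ∈ Submodule.span ℂ (Set.range (Sum.elim e f)), inner ℂ v x = 0 :=
      (Submodule.mem_orthogonal _ _).1 hx
    refine h.eq_zero_of_forall_joint_eigenvector fun μ g v hv0 hK hG => ?_
    -- A joint eigenvector with `g = 0` is an eigenvector of `T'T` and belongs to a rung of the
    -- ladder; otherwise `g = κ` and it lies in the span of the `e i`.
    by_cases hg : g = 0
    · rw [hg, zero_smul] at hG
      have hμ : μ ≠ 0 := by
        rintro rfl
        rw [zero_smul] at hK
        exact hv0 (h.K_eq_zero hK)
      have h1 := h.isLevel_of_K hG hμ hK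
      obtain ⟨n, hn⟩ := h.level_eq_natCast_mul h1 hv0
      rw [hn] at h1
      refine hx1 v (Submodule.span_mono ?_ (hf5 n v h1))
      rintro _ ⟨k, rfl⟩
      exact ⟨.inr (n, k), rfl⟩
    · rw [h.eigenvalue_eq hg hv0 hG] at hG
      refine hx1 v (Submodule.span_mono ?_ (he3 v hG))
      rintro _ ⟨i, rfl⟩
      exact ⟨.inl i, rfl⟩
  set b := HilbertBasis.mkOfOrthogonalEqBot hv hperp with hb
  have hbv : ⇑b = Sum.elim e f := HilbertBasis.coe_mkOfOrthogonalEqBot hv hperp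
  refine ⟨q, m, l, b, .of_right h.adj (ladderShift_injective _ _) ?_, ?_, ?_⟩
  · rw [hbv]
    rintro (i | ⟨n, k⟩)
    · exact (he2 i).1
    · exact (hf4 n k).1
  · rw [hbv]
    exact fun i => (he2 i).2.2
  · rw [hbv]
    exact hf2

end IsYangMillsSystem
end System
end Fluxon
namespace Fluxon

/-! ### Weighted backward shifts on `ℓ²` -/

section Weighted

variable {J : Type*}

/-- The standard Hilbert basis of `ℓ²`. -/
def standardBasis (J : Type*) : HilbertBasis J ℂ ℓ²(J, ℂ) :=
  HilbertBasis.ofRepr (LinearIsometryEquiv.refl ℂ _)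

lemma inner_standardBasis (j : J) (x : ℓ²(J, ℂ)) : inner ℂ (standardBasis J j) x = x j :=
  ((standardBasis J).repr_apply_apply x j).symm

lemma standardBasis_apply [DecidableEq J] (j : J) :
    standardBasis J j = lp.single 2 j (1 : ℂ) := by
  rw [← (standardBasis J).repr_symm_single]
  rfl

lemma hasSum_norm_sq (x : ℓ²(J, ℂ)) : HasSum (fun j => ‖x j‖ ^ 2) (‖x‖ ^ 2) := by
  simpa only [inner_standardBasis] using hilbertBasis_hasSum_norm_sq (standardBasis J) x

lemma memℓp_two_iff {x : J → ℂ} : Memℓp x 2 ↔ Summable fun j => ‖x j‖ ^ 2 := by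
  rw [memℓp_gen_iff (by norm_num)]
  simp

lemma memℓp_weighted {s : J → J} (hs : Function.Injective s) {w : J → ℂ} {C : ℝ}
    (hw : ∀ j, ‖w j‖ ≤ C) (x : ℓ²(J, ℂ)) : Memℓp (fun j => w j * x (s j)) 2 := by
  rw [memℓp_two_iff]
  refine Summable.of_nonneg_of_le (fun j => by positivity) (fun j => ?_)
    (((hasSum_norm_sq x).summable.comp_injective hs).mul_left (C ^ 2))
  rw [norm_mul, mul_pow]
  exact mul_le_mul_of_nonneg_right (pow_le_pow_left₀ (norm_nonneg _) (hw j) 2) (by positivity)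

/-- The bounded operator `x ↦ (w j * x (s j))_j`. -/
def weightedShift {s : J → J} (hs : Function.Injective s) {w : J → ℂ} {C : ℝ} (hC : 0 ≤ C)
    (hw : ∀ j, ‖w j‖ ≤ C) : ℓ²(J, ℂ) →L[ℂ] ℓ²(J, ℂ) :=
  LinearMap.mkContinuous
    { toFun := fun x => ⟨_, memℓp_weighted hs hw x⟩
      map_add' := fun x y => by
        ext j
        exact mul_add _ _ _
      map_smul' := fun c x => by
        ext j
        exact mul_left_comm _ _ _ } C (fun x => by
    refine le_of_sq_le_sq ?_ (by positivity)
    rw [mul_pow]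
    refine hasSum_le_inj s hs (fun j _ => by positivity) (fun j => ?_) (hasSum_norm_sq _)
      ((hasSum_norm_sq x).mul_left (C ^ 2))
    change ‖w j * x (s j)‖ ^ 2 ≤ _
    rw [norm_mul, mul_pow]
    exact mul_le_mul_of_nonneg_right (pow_le_pow_left₀ (norm_nonneg _) (hw j) 2) (by positivity))

lemma weightedShift_apply {s : J → J} (hs : Function.Injective s) {w : J → ℂ} {C : ℝ} (hC : 0 ≤ C)
    (hw : ∀ j, ‖w j‖ ≤ C) (x : ℓ²(J, ℂ)) (j : J) :
    weightedShift hs hC hw x j = w j * x (s j) := rfl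

lemma norm_weightedShift_le {s : J → J} (hs : Function.Injective s) {w : J → ℂ} {C : ℝ}
    (hC : 0 ≤ C) (hw : ∀ j, ‖w j‖ ≤ C) : ‖weightedShift hs hC hw‖ ≤ C :=
  LinearMap.mkContinuous_norm_le _ hC _

lemma isCompactOperator_rankOne {H : Type*} [NormedAddCommGroup H] [InnerProductSpace ℂ H]
    (x y : H) : IsCompactOperator (InnerProductSpace.rankOne ℂ x y) := by
  rw [InnerProductSpace.rankOne_def']
  exact IsCompactOperator.comp_clm
    (isCompactOperator_of_locallyCompactSpace_rng (ContinuousLinearMap.toSpanSingleton ℂ x)) _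

/-- Finite truncations have finite rank and converge in norm, since only finitely many weights
exceed a given size. -/
lemma isCompactOperator_diagonal {w : J → ℂ} {C : ℝ} (hC : 0 ≤ C) (hw : ∀ j, ‖w j‖ ≤ C)
    (hfin : ∀ ε > 0, {j | ε ≤ ‖w j‖}.Finite) :
    IsCompactOperator (weightedShift (s := id) Function.injective_id hC hw) := by
  classical
  let F : Finset J → (ℓ²(J, ℂ) →L[ℂ] ℓ²(J, ℂ)) := fun s =>
    ∑ j ∈ s, w j • InnerProductSpace.rankOne ℂ (standardBasis J j) (standardBasis J j)
  have hF : ∀ s x j, F s x j = if j ∈ s then w j * x j else 0 := by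
    intro s x j
    simp only [F]
    rw [← inner_standardBasis j, sum_apply, inner_sum]
    simp only [smul_apply, InnerProductSpace.rankOne_apply, inner_smul_right,
      hilbertBasis_inner_eq, inner_standardBasis]
    simp
  refine isCompactOperator_of_tendsto (l := Filter.atTop) (F := F) ?_ (.of_forall fun s => ?_)
  · rw [Metric.tendsto_atTop]
    intro ε hε
    refine ⟨(hfin (ε / 2) (by positivity)).toFinset, fun s hs => ?_⟩
    have hw' : ∀ j, ‖(if j ∈ s then 0 else w j)‖ ≤ ε / 2 := by
      intro j
      split_ifs with hj
      · rw [norm_zero]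
        positivity
      · by_contra! hcon
        exact hj (hs (by simpa using hcon.le))
    have : weightedShift (s := id) Function.injective_id hC hw - F s =
        weightedShift (s := id) Function.injective_id (by positivity) hw' := by
      ext x j
      change weightedShift (s := id) Function.injective_id hC hw x j - F s x j = _
      rw [hF, weightedShift_apply, weightedShift_apply]
      split_ifs <;> simp
    rw [dist_comm, dist_eq_norm, this]
    exact (norm_weightedShift_le _ _ _).trans_lt (by linarith)
  · induction s using Finset.induction_on with
    | empty => exact isCompactOperator_zero
    | insert a s ha ih =>
      simp only [F]
      rw [Finset.sum_insert ha]
      exact ((isCompactOperator_rankOne _ _).smul _).add ih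

end Weighted

/-! ### The ladder operators and their bounded perturbations -/

section Ladder

variable {N : ℕ}

/-- The index map raising the level. -/
def levelUp (N : ℕ) : ℕ × Fin N → ℕ × Fin N := Prod.map Nat.succ id

lemma levelUp_injective : Function.Injective (levelUp N) :=
  Nat.succ_injective.prodMap Function.injective_id

lemma exists_zero_of_notMem_levelUp {p : ℕ × Fin N} (hp : p ∉ Set.range (levelUp N)) :
    p.1 = 0 := by
  rcases p with ⟨_ | n, k⟩
  · rfl
  · exact absurd ⟨(n, k), rfl⟩ hp

lemma numberBasis_eq (p : ℕ × Fin N) : (numberBasis p : FockSpace N) = standardBasis _ p := by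
  rw [standardBasis_apply]
  exact rfl

lemma annihilation_apply (ψ : numberDomain N) (p : ℕ × Fin N) :
    annihilation N ψ p = ((√((p.1 : ℝ) + 1) : ℝ) : ℂ) * (ψ : FockSpace N) (levelUp N p) := rfl

lemma creation_apply (ψ : numberDomain N) (p : ℕ × Fin N) :
    creation N ψ (levelUp N p) = ((√((p.1 : ℝ) + 1) : ℝ) : ℂ) * (ψ : FockSpace N) p := by
  change ((√(((p.1 + 1 : ℕ)) : ℝ) : ℝ) : ℂ) * _ = _
  push_cast
  rfl

lemma creation_apply_zero (ψ : numberDomain N) {p : ℕ × Fin N} (hp : p.1 = 0) :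
    creation N ψ p = 0 := by
  change ((√((p.1 : ℕ) : ℝ) : ℝ) : ℂ) * _ = _
  simp [hp]

lemma creation_numberBasis (p : ℕ × Fin N) :
    creation N (numberBasis p) = ((√((p.1 : ℝ) + 1) : ℝ) : ℂ) • standardBasis _ (levelUp N p) := by
  classical
  refine hilbertBasis_ext (standardBasis _) fun j => ?_
  rw [inner_standardBasis, inner_smul_right, hilbertBasis_inner_eq]
  by_cases hj : j ∈ Set.range (levelUp N)
  · obtain ⟨r, rfl⟩ := hj
    rw [creation_apply, numberBasis_eq, ← inner_standardBasis r, hilbertBasis_inner_eq]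
    simp only [levelUp_injective.eq_iff]
    split_ifs with h
    · rw [h]
    · simp
  · rw [creation_apply_zero _ (exists_zero_of_notMem_levelUp hj), if_neg, mul_zero]
    rintro rfl
    exact hj ⟨p, rfl⟩

lemma annihilation_numberBasis (p : ℕ × Fin N) :
    annihilation N (numberBasis (levelUp N p)) =
      ((√((p.1 : ℝ) + 1) : ℝ) : ℂ) • standardBasis _ p := by
  classical
  refine hilbertBasis_ext (standardBasis _) fun j => ?_
  rw [inner_standardBasis, inner_smul_right, hilbertBasis_inner_eq, annihilation_apply,
    numberBasis_eq, ← inner_standardBasis (levelUp N j), hilbertBasis_inner_eq]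
  simp only [levelUp_injective.eq_iff]
  split_ifs with h
  · rw [h]
  · simp

lemma annihilation_numberBasis_zero {p : ℕ × Fin N} (hp : p.1 = 0) :
    annihilation N (numberBasis p) = 0 := by
  classical
  refine hilbertBasis_ext (standardBasis _) fun j => ?_
  rw [inner_standardBasis, inner_zero_right, annihilation_apply, numberBasis_eq,
    ← inner_standardBasis (levelUp N j), hilbertBasis_inner_eq, if_neg, mul_zero]
  rintro rfl
  exact absurd hp (Nat.succ_ne_zero _)

lemma inner_creation (φ ψ : numberDomain N) :
    inner ℂ (creation N ψ) (φ : FockSpace N) = inner ℂ (ψ : FockSpace N) (annihilation N φ) := by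
  refine IsShiftBasis.shift_pairing (σ := fun p => ((√((p.1 : ℝ) + 1) : ℝ) : ℂ)) levelUp_injective
    (standardBasis _) (fun j => ?_) (fun j hj => ?_) fun j => ?_
  · rw [inner_standardBasis, inner_standardBasis, creation_apply]
  · rw [inner_standardBasis, creation_apply_zero _ (exists_zero_of_notMem_levelUp hj)]
  · rw [inner_standardBasis, inner_standardBasis, annihilation_apply, Complex.conj_ofReal]

lemma mem_numberDomain_of_summable {x : FockSpace N}
    (h : Summable fun p : ℕ × Fin N => ((p.1 : ℝ) + 1) * ‖x (levelUp N p)‖ ^ 2) :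
    x ∈ numberDomain N := by
  rw [mem_numberDomain, ← levelUp_injective.summable_iff]
  · refine h.congr fun p => ?_
    simp [levelUp]
  · intro p hp
    simp [exists_zero_of_notMem_levelUp hp]

/-- Testing against the number basis determines all coordinates of `y`, and square summability of
these coordinates forces `x` into the number domain. -/
lemma adjointPair_ladder (N : ℕ) : AdjointPair (annihilation N) (creation N) := by
  have hsq : ∀ p : ℕ × Fin N, √((p.1 : ℝ) + 1) ^ 2 = (p.1 : ℝ) + 1 := fun p =>
    Real.sq_sqrt (by positivity)
  constructor
  · intro x y
    constructor
    · rintro ⟨hx, rfl⟩ φ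
      exact inner_creation ⟨x, hx⟩ φ
    · intro h
      have hy : ∀ p, y p = ((√((p.1 : ℝ) + 1) : ℝ) : ℂ) * x (levelUp N p) := by
        intro p
        have := h (numberBasis p)
        rw [creation_numberBasis, numberBasis_eq, inner_smul_left, inner_standardBasis,
          inner_standardBasis, Complex.conj_ofReal] at this
        exact this.symm
      have hx : x ∈ numberDomain N := by
        refine mem_numberDomain_of_summable ((hasSum_norm_sq y).summable.congr fun p => ?_)
        rw [hy, norm_mul, mul_pow, Complex.norm_real, Real.norm_eq_abs, sq_abs, hsq]
      refine ⟨hx, ?_⟩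
      ext p
      rw [annihilation_apply, hy]
  · intro x y
    constructor
    · rintro ⟨hx, rfl⟩ φ
      rw [← inner_conj_symm, ← inner_creation φ ⟨x, hx⟩, inner_conj_symm]
    · intro h
      have hy : ∀ p, y (levelUp N p) = ((√((p.1 : ℝ) + 1) : ℝ) : ℂ) * x p := by
        intro p
        have := h (numberBasis (levelUp N p))
        rw [annihilation_numberBasis, numberBasis_eq, inner_smul_left, inner_standardBasis,
          inner_standardBasis, Complex.conj_ofReal] at this
        exact this.symm
      have hy0 : ∀ p : ℕ × Fin N, p.1 = 0 → y p = 0 := by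
        intro p hp
        have := h (numberBasis p)
        rw [annihilation_numberBasis_zero hp, numberBasis_eq, inner_zero_left,
          inner_standardBasis] at this
        exact this.symm
      have hx : x ∈ numberDomain N := by
        rw [mem_numberDomain]
        refine Summable.of_nonneg_of_le (fun p => by positivity) (fun p => ?_)
          ((hasSum_norm_sq y).summable.comp_injective levelUp_injective)
        simp only [Function.comp]
        rw [hy, norm_mul, mul_pow, Complex.norm_real, Real.norm_eq_abs, sq_abs, hsq]
        nlinarith [sq_nonneg ‖x p‖]
      refine ⟨hx, ?_⟩
      ext p
      by_cases hp : p ∈ Set.range (levelUp N)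
      · obtain ⟨r, rfl⟩ := hp
        rw [creation_apply, hy]
      · rw [creation_apply_zero _ (exists_zero_of_notMem_levelUp hp),
          hy0 _ (exists_zero_of_notMem_levelUp hp)]

/-- A bounded term can be moved to the other side: `(x, y)` is in the graph of `cT + X` exactly when
`(x, c⁻¹(y - X x))` is in the graph of `T`, and the adjointness condition transforms the same way.
-/
lemma adjointPair_perturbation {H : Type*} [NormedAddCommGroup H] [InnerProductSpace ℂ H]
    [CompleteSpace H] {𝒟 : Submodule ℂ H} {T T' : 𝒟 →ₗ[ℂ] H} (h : AdjointPair T T') {c : ℝ}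
    (hc : c ≠ 0) (X : H →L[ℂ] H) :
    AdjointPair ((c : ℂ) • T + (X : H →ₗ[ℂ] H) ∘ₗ 𝒟.subtype)
      ((c : ℂ) • T' + (ContinuousLinearMap.adjoint X : H →ₗ[ℂ] H) ∘ₗ 𝒟.subtype) := by
  have hc' : (c : ℂ) ≠ 0 := by exact_mod_cast hc
  have key : ∀ {S : 𝒟 →ₗ[ℂ] H} {Y : H →L[ℂ] H} {x y : H},
      Maps ((c : ℂ) • S + (Y : H →ₗ[ℂ] H) ∘ₗ 𝒟.subtype) x y ↔ Maps S x ((c : ℂ)⁻¹ • (y - Y x)) := by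
    intro S Y x y
    refine exists_congr fun hx => ?_
    change (c : ℂ) • S ⟨x, hx⟩ + Y x = y ↔ _
    rw [eq_inv_smul_iff₀ hc', eq_sub_iff_add_eq]
  constructor
  · intro x y
    rw [key, h.maps_left]
    refine forall_congr' fun φ => ?_
    change _ ↔ inner ℂ ((c : ℂ) • T' φ + ContinuousLinearMap.adjoint X φ) x = _
    rw [inner_add_left, inner_smul_left, Complex.conj_ofReal,
      ContinuousLinearMap.adjoint_inner_left, inner_smul_right, inner_sub_right,
      eq_inv_mul_iff_mul_eq₀ hc', eq_sub_iff_add_eq]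
  · intro x y
    rw [key, h.maps_right]
    refine forall_congr' fun φ => ?_
    change _ ↔ inner ℂ ((c : ℂ) • T φ + X φ) x = _
    rw [inner_add_left, inner_smul_left, Complex.conj_ofReal, ← ContinuousLinearMap.adjoint_inner_right,
      inner_smul_right, inner_sub_right, eq_inv_mul_iff_mul_eq₀ hc', eq_sub_iff_add_eq]

/-! ### The covariant derivatives as an adjoint pair. -/

/-- The bounded part of `D̄`. -/
def connection (A : GaugeField N) : Operators N :=
  (1 / 2 : ℂ) • ((A 0 : Operators N) + Complex.I • (A 1 : Operators N))

lemma adjoint_connection (A : GaugeField N) : ContinuousLinearMap.adjoint (connection A) =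
    -((1 / 2 : ℂ) • ((A 0 : Operators N) - Complex.I • (A 1 : Operators N))) := by
  have h0 : star (A 0 : Operators N) = -(A 0 : Operators N) := skewAdjoint.mem_iff.1 (A 0).2
  have h1 : star (A 1 : Operators N) = -(A 1 : Operators N) := skewAdjoint.mem_iff.1 (A 1).2
  rw [← ContinuousLinearMap.star_eq_adjoint, connection, star_smul, star_add, star_smul, h0, h1]
  simp only [RCLike.star_def, map_div₀, map_one, map_ofNat, Complex.conj_I]
  rw [← smul_neg]
  congr 1
  rw [neg_smul, smul_neg]
  abel

lemma covDbar_eq (θ : ℝ) (A : GaugeField N) : covDbar θ A =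
    ((1 / √(2 * θ) : ℝ) : ℂ) • annihilation N +
      (connection A : FockSpace N →ₗ[ℂ] FockSpace N) ∘ₗ (numberDomain N).subtype := rfl

lemma neg_covD_eq (θ : ℝ) (A : GaugeField N) : -covD θ A =
    ((1 / √(2 * θ) : ℝ) : ℂ) • creation N +
      (ContinuousLinearMap.adjoint (connection A) : FockSpace N →ₗ[ℂ] FockSpace N) ∘ₗ
        (numberDomain N).subtype := by
  rw [adjoint_connection, covD, neg_add, neg_neg]
  rfl

lemma adjointPair_cov {θ : ℝ} (hθ : 0 < θ) (A : GaugeField N) :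
    AdjointPair (covDbar θ A) (-covD θ A) := by
  rw [covDbar_eq, neg_covD_eq]
  exact adjointPair_perturbation (adjointPair_ladder N) (by positivity) _

end Ladder
end Fluxon
namespace Fluxon

/-! ### The resolvent of `D̄† D̄` -/

section Resolvent

variable {N : ℕ}

lemma norm_inv_sqrt_le (p : ℕ × Fin N) : ‖((√((p.1 : ℝ) + 1) : ℝ) : ℂ)⁻¹‖ ≤ 1 := by
  rw [norm_inv, Complex.norm_real, Real.norm_eq_abs, abs_of_nonneg (Real.sqrt_nonneg _)]
  refine inv_le_one_of_one_le₀ ?_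
  rw [Real.one_le_sqrt]
  simp

lemma norm_quotient_le (p : ℕ × Fin N) :
    ‖((√((p.1 : ℝ) + 1) : ℝ) : ℂ) * ((√((p.1 : ℝ) + 1 + 1) : ℝ) : ℂ)⁻¹‖ ≤ 1 := by
  have h0 : 0 < √((p.1 : ℝ) + 1 + 1) := by positivity
  rw [norm_mul, norm_inv, Complex.norm_real, Complex.norm_real, Real.norm_eq_abs, Real.norm_eq_abs,
    abs_of_nonneg (Real.sqrt_nonneg _), abs_of_nonneg (Real.sqrt_nonneg _), ← div_eq_mul_inv,
    div_le_one h0]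
  exact Real.sqrt_le_sqrt (by linarith)

/-- The operator `(1 + a† a)^{-1/2}`. -/
def rootResolvent (N : ℕ) : Operators N :=
  weightedShift (s := id) Function.injective_id zero_le_one norm_inv_sqrt_le

/-- The operator `a (1 + a† a)^{-1/2}`. -/
def lowering (N : ℕ) : Operators N :=
  weightedShift (s := levelUp N) levelUp_injective zero_le_one norm_quotient_le

lemma rootResolvent_apply (x : FockSpace N) (p : ℕ × Fin N) :
    rootResolvent N x p = ((√((p.1 : ℝ) + 1) : ℝ) : ℂ)⁻¹ * x p := rfl

lemma lowering_apply (x : FockSpace N) (p : ℕ × Fin N) : lowering N x p =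
    ((√((p.1 : ℝ) + 1) : ℝ) : ℂ) * ((√((p.1 : ℝ) + 1 + 1) : ℝ) : ℂ)⁻¹ * x (levelUp N p) := rfl

lemma norm_sq_rootResolvent (x : FockSpace N) (p : ℕ × Fin N) :
    ‖rootResolvent N x p‖ ^ 2 = ((p.1 : ℝ) + 1)⁻¹ * ‖x p‖ ^ 2 := by
  rw [rootResolvent_apply, norm_mul, mul_pow, norm_inv, Complex.norm_real, Real.norm_eq_abs,
    abs_of_nonneg (Real.sqrt_nonneg _), inv_pow, Real.sq_sqrt (by positivity)]

lemma norm_sq_lowering (x : FockSpace N) (p : ℕ × Fin N) :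
    ‖lowering N x p‖ ^ 2 =
      ((p.1 : ℝ) + 1) * ((p.1 : ℝ) + 1 + 1)⁻¹ * ‖x (levelUp N p)‖ ^ 2 := by
  rw [lowering_apply, norm_mul, mul_pow, norm_mul, norm_inv, mul_pow, inv_pow, Complex.norm_real,
    Complex.norm_real, Real.norm_eq_abs, Real.norm_eq_abs, sq_abs, sq_abs,
    Real.sq_sqrt (by positivity), Real.sq_sqrt (by positivity)]

lemma rootResolvent_mem (x : FockSpace N) : rootResolvent N x ∈ numberDomain N := by
  rw [mem_numberDomain]
  refine Summable.of_nonneg_of_le (fun p => by positivity) (fun p => ?_)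
    (hasSum_norm_sq x).summable
  rw [norm_sq_rootResolvent, ← mul_assoc]
  refine mul_le_of_le_one_left (by positivity) ?_
  rw [← div_eq_mul_inv, div_le_one (by positivity)]
  linarith

lemma annihilation_rootResolvent (x : FockSpace N) :
    annihilation N ⟨rootResolvent N x, rootResolvent_mem x⟩ = lowering N x := by
  ext p
  rw [annihilation_apply, lowering_apply]
  simp only [rootResolvent_apply, levelUp, Prod.map_fst, Nat.succ_eq_add_one, Nat.cast_add,
    Nat.cast_one, mul_assoc]

lemma exists_rootResolvent_eq (φ : numberDomain N) : ∃ x, rootResolvent N x = φ := by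
  have h : Memℓp (fun p : ℕ × Fin N => ((√((p.1 : ℝ) + 1) : ℝ) : ℂ) * (φ : FockSpace N) p) 2 := by
    rw [memℓp_two_iff]
    refine ((mem_numberDomain.1 φ.2).add (summable_normSq (φ : FockSpace N))).congr fun p => ?_
    rw [norm_mul, mul_pow, Complex.norm_real, Real.norm_eq_abs, sq_abs,
      Real.sq_sqrt (by positivity)]
    ring
  refine ⟨⟨_, h⟩, ?_⟩
  ext p
  rw [rootResolvent_apply]
  change _ * (_ * _) = _
  rw [← mul_assoc, inv_mul_cancel₀, one_mul]
  have : √((p.1 : ℝ) + 1) ≠ 0 := by positivity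
  exact_mod_cast this

lemma isCompactOperator_rootResolvent (N : ℕ) : IsCompactOperator (rootResolvent N) := by
  refine isCompactOperator_diagonal _ _ fun ε hε => ?_
  obtain ⟨m, hm⟩ := exists_nat_gt (ε ^ 2)⁻¹
  refine (((Finset.range m) ×ˢ (Finset.univ : Finset (Fin N))).finite_toSet).subset ?_
  rintro ⟨n, k⟩ hp
  simp only [Finset.coe_product, Finset.coe_range, Finset.coe_univ, Set.mem_prod, Set.mem_Iio,
    Set.mem_univ, and_true]
  by_contra! hmn
  simp only [Set.mem_ofPred_eq, norm_inv, Complex.norm_real, Real.norm_eq_abs,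
    abs_of_nonneg (Real.sqrt_nonneg _)] at hp
  have h1 := pow_le_pow_left₀ hε.le hp 2
  rw [inv_pow, Real.sq_sqrt (by positivity)] at h1
  have h2 : (n : ℝ) + 1 ≤ (ε ^ 2)⁻¹ := by
    rw [← inv_inv ((n : ℝ) + 1)]
    exact inv_anti₀ (by positivity) h1
  have h3 : (m : ℝ) ≤ n := by exact_mod_cast hmn
  linarith

/-- At level `n` the two operators contribute `1/(n+1)` and `n/(n+1)`. -/
lemma norm_sq_eq (x : FockSpace N) :
    ‖x‖ ^ 2 = ‖rootResolvent N x‖ ^ 2 + ‖lowering N x‖ ^ 2 := by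
  have h1 := hasSum_norm_sq (rootResolvent N x)
  have h2 : HasSum (fun p : ℕ × Fin N => (p.1 : ℝ) * ((p.1 : ℝ) + 1)⁻¹ * ‖x p‖ ^ 2)
      (‖lowering N x‖ ^ 2) := by
    rw [← levelUp_injective.hasSum_iff]
    · refine (hasSum_norm_sq (lowering N x)).congr_fun fun p => ?_
      rw [norm_sq_lowering]
      simp [levelUp]
    · intro p hp
      simp [exists_zero_of_notMem_levelUp hp]
  refine (hasSum_norm_sq x).unique ((h1.add h2).congr_fun fun p => ?_)
  rw [norm_sq_rootResolvent]
  have : (p.1 : ℝ) + 1 ≠ 0 := by positivity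
  field_simp
  ring

/-- The domain is the range of the compact `R = (1 + a†a)^{-1/2}`, and `W = D̄ R` is bounded.
Pulling `‖φ‖² + ‖D̄ φ‖²` back along `R` gives the form of `Q = R*R + W*W`, which is coercive and so
invertible. Then `K = R Q⁻¹ R*`, compact because `R` is. -/
lemma exists_resolvent {θ : ℝ} (hθ : 0 < θ) (A : GaugeField N) :
    ∃ K : Operators N, IsCompactOperator K ∧
      ∀ x, ∃ y, Maps (covDbar θ A) (K x) y ∧ Maps (-covD θ A) y (x - K x) := by
  set c : ℝ := 1 / √(2 * θ) with hc
  have hc0 : 0 < c := by positivity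
  set R := rootResolvent N with hR
  set X := connection A with hX
  set W : Operators N := (c : ℂ) • lowering N + X ∘L R with hW
  have hWR : ∀ x, Maps (covDbar θ A) (R x) (W x) := fun x => by
    refine ⟨rootResolvent_mem x, ?_⟩
    rw [covDbar_eq]
    change (c : ℂ) • annihilation N ⟨rootResolvent N x, rootResolvent_mem x⟩ + X (R x) = _
    rw [annihilation_rootResolvent]
    rfl
  set Q : Operators N := ContinuousLinearMap.adjoint R ∘L R + ContinuousLinearMap.adjoint W ∘L W
    with hQ
  have hQin : ∀ x y, inner ℂ (Q x) y = inner ℂ (R x) (R y) + inner ℂ (W x) (W y) := fun x y => by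
    change inner ℂ (ContinuousLinearMap.adjoint R (R x) + ContinuousLinearMap.adjoint W (W x)) y = _
    rw [inner_add_left, ContinuousLinearMap.adjoint_inner_left,
      ContinuousLinearMap.adjoint_inner_left]
  -- The constant comes from inserting `c‖aR x‖ ≤ ‖W x‖ + ‖X‖‖R x‖`, squared, into `norm_sq_eq`.
  set M : ℝ := 1 + 2 * (c ^ 2)⁻¹ * (1 + ‖X‖ ^ 2) with hM
  have hM0 : 0 < M := by positivity
  have hbound : ∀ x, ‖x‖ ^ 2 ≤ M * (‖R x‖ ^ 2 + ‖W x‖ ^ 2) := by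
    intro x
    have h1 : c * ‖lowering N x‖ ≤ ‖W x‖ + ‖X‖ * ‖R x‖ := by
      have h2 : (c : ℂ) • lowering N x = W x - X (R x) := (add_sub_cancel_right _ _).symm
      calc c * ‖lowering N x‖ = ‖(c : ℂ) • lowering N x‖ := by
            rw [norm_smul, Complex.norm_real, Real.norm_eq_abs, abs_of_pos hc0]
        _ ≤ ‖W x‖ + ‖X (R x)‖ := by
            rw [h2]
            exact norm_sub_le _ _
        _ ≤ _ := by
            gcongr
            exact X.le_opNorm _
    have h2 : c ^ 2 * ‖lowering N x‖ ^ 2 ≤ 2 * ‖W x‖ ^ 2 + 2 * (‖X‖ ^ 2 * ‖R x‖ ^ 2) := by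
      have h3 := pow_le_pow_left₀ (by positivity) h1 2
      nlinarith [sq_nonneg (‖W x‖ - ‖X‖ * ‖R x‖)]
    have h3 : ‖lowering N x‖ ^ 2 ≤ (c ^ 2)⁻¹ * (2 * ‖W x‖ ^ 2 + 2 * (‖X‖ ^ 2 * ‖R x‖ ^ 2)) := by
      rw [← div_eq_inv_mul, le_div_iff₀ (by positivity)]
      linarith
    have h4 : 0 ≤ ‖W x‖ ^ 2 := by positivity
    have h5 : 0 ≤ (c ^ 2)⁻¹ * ‖R x‖ ^ 2 := by positivity
    have h6 : 0 ≤ (c ^ 2)⁻¹ * (‖X‖ ^ 2 * ‖W x‖ ^ 2) := by positivity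
    rw [norm_sq_eq, hM]
    nlinarith
  have hunit : IsUnit Q := by
    refine ContinuousLinearMap.isUnit_of_forall_le_norm_inner_map Q (c := ⟨M⁻¹, by positivity⟩)
      (inv_pos.2 hM0) fun x => ?_
    change ‖x‖ ^ 2 * M⁻¹ ≤ _
    rw [hQin, inner_self_eq_norm_sq_to_K, inner_self_eq_norm_sq_to_K]
    have : (((‖R x‖ : ℝ) : ℂ) ^ 2 + ((‖W x‖ : ℝ) : ℂ) ^ 2) = ((‖R x‖ ^ 2 + ‖W x‖ ^ 2 : ℝ) : ℂ) := by
      push_cast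
      rfl
    change _ ≤ ‖(((‖R x‖ : ℝ) : ℂ) ^ 2 + ((‖W x‖ : ℝ) : ℂ) ^ 2)‖
    rw [this, Complex.norm_real, Real.norm_eq_abs, abs_of_nonneg (by positivity),
      ← div_eq_mul_inv, div_le_iff₀ hM0, mul_comm]
    exact hbound x
  obtain ⟨P, hP, -⟩ := isUnit_iff_exists.1 hunit
  have hQP : ∀ x, Q (P x) = x := fun x => congrArg (fun L : Operators N => L x) hP
  refine ⟨R ∘L (P ∘L ContinuousLinearMap.adjoint R),
    (isCompactOperator_rootResolvent N).comp_clm (P ∘L ContinuousLinearMap.adjoint R), fun x => ?_⟩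
  set u := P (ContinuousLinearMap.adjoint R x) with hu
  -- On a test vector `φ = R g` the claim reads `⟨W g, W u⟩ = ⟨g, Q u⟩ - ⟨R g, R u⟩` with `Q u = R*
  -- x`.
  refine ⟨W u, hWR u, (adjointPair_cov hθ A).maps_right.2 fun φ => ?_⟩
  obtain ⟨g, hg⟩ := exists_rootResolvent_eq φ
  have h1 := hQin u g
  rw [hu, hQP, ← hu, ContinuousLinearMap.adjoint_inner_left] at h1
  have h2 : covDbar θ A φ = W g := by
    have := hWR g
    rw [hR, hg] at this
    exact (Maps.of_coe φ).unique this
  change inner ℂ _ (W u) = inner ℂ _ (x - R u)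
  rw [h2, ← hg, ← inner_conj_symm, ← inner_conj_symm (rootResolvent N g), inner_sub_left, h1]
  congr 1
  ring

end Resolvent

/-! ### Traces -/

section Trace

/-- An infinite orthonormal family of eigenvectors, completed to a Hilbert basis, would put the same
nonzero number on the diagonal infinitely often, so the diagonal sum could not converge. -/
lemma finiteDimensional_of_hasTrace {θ : ℝ} (hθ : 0 < θ) {N : ℕ} (hN : 1 ≤ N) {F : Operators N}
    {t : ℂ} (hF : HasTrace θ F t) {g : ℂ} (hg : g ≠ 0) :
    FiniteDimensional ℂ (Module.End.eigenspace (F : FockSpace N →ₗ[ℂ] FockSpace N) g) := by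
  classical
  set E := Module.End.eigenspace (F : FockSpace N →ₗ[ℂ] FockSpace N) g with hE
  have hmem : ∀ x : FockSpace N, x ∈ E ↔ F x = g • x := fun x => Module.End.mem_eigenspace_iff
  have hclosed : IsClosed (E : Set (FockSpace N)) := by
    have : (E : Set (FockSpace N)) = {x | F x = g • x} := Set.ext fun x => hmem x
    rw [this]
    exact isClosed_eq F.continuous (continuous_const_smul g)
  have : CompleteSpace E := hclosed.completeSpace_coe
  obtain ⟨w, b, hb⟩ := exists_hilbertBasis ℂ E
  by_cases hw : w.Finite
  · have := hw.fintype
    exact b.toOrthonormalBasis.toBasis.finiteDimensional_of_finite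
  exfalso
  have hw' : Infinite w := Set.infinite_coe_iff.2 hw
  have hon : Orthonormal ℂ fun i => (b i : FockSpace N) :=
    b.orthonormal.comp_linearIsometry (Submodule.subtypeₗᵢ _)
  obtain ⟨v, d, hv, hd⟩ := hon.toSubtypeRange.exists_hilbertBasis_extension
  have hvinf : v.Infinite := (Set.infinite_range_of_injective hon.linearIndependent.injective).mono hv
  -- Traces are tested on bases indexed by `ℕ × Fin N`, so the completed basis has to be countable.
  -- Each of its vectors overlaps some standard basis vector, and each of the latter overlaps only
  -- countably many.
  have hvc : v.Countable := by
    have h1 : v ⊆ ⋃ p : ℕ × Fin N, {x | x ∈ v ∧ inner ℂ x (standardBasis _ p) ≠ 0} := by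
      intro x hx
      rw [Set.mem_iUnion]
      by_contra! hcon
      have hx0 : x = 0 := by
        refine hilbertBasis_ext (standardBasis _) fun p => ?_
        rw [inner_zero_right, inner_eq_zero_symm]
        by_contra hne
        exact hcon p ⟨hx, hne⟩
      have h2 := d.orthonormal.1 ⟨x, hx⟩
      rw [hd] at h2
      simp [hx0] at h2
    refine (Set.countable_iUnion fun p => ?_).mono h1
    have h3 := (hilbertBasis_hasSum_norm_sq d (standardBasis _ p)).summable.countable_support
    refine (h3.image Subtype.val).mono ?_
    rintro x ⟨hx, hne⟩
    refine ⟨⟨x, hx⟩, ?_, rfl⟩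
    rw [Function.mem_support, hd]
    simpa using hne
  have : Infinite v := hvinf.to_subtype
  have : Countable v := hvc.to_subtype
  have : NeZero N := ⟨by omega⟩
  obtain ⟨e⟩ : Nonempty (v ≃ ℕ × Fin N) := nonempty_equiv_of_countable
  obtain ⟨d', hd'⟩ := exists_hilbertBasis_reindex d e.symm
  rw [hd] at hd'
  have hsum := (hF d').summable.tendsto_cofinite_zero
  have hcθ : (2 * Real.pi * θ : ℂ) * g ≠ 0 := by
    refine mul_ne_zero ?_ hg
    have : 2 * Real.pi * θ ≠ 0 := by positivity
    exact_mod_cast this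
  have hev := hsum.norm.eventually (gt_mem_nhds (norm_zero.trans_lt (norm_pos_iff.2 hcθ)))
  rw [Filter.eventually_cofinite] at hev
  let j : w → ℕ × Fin N := fun i => e ⟨(b i : FockSpace N), hv ⟨i, rfl⟩⟩
  have hj : Function.Injective j := fun i i' h =>
    hon.linearIndependent.injective (congrArg (Subtype.val : v → FockSpace N) (e.injective h))
  refine (Set.infinite_range_of_injective hj) (hev.subset ?_)
  rintro _ ⟨i, rfl⟩
  have h1 : d' (j i) = (b i : FockSpace N) := by simp [hd', j]
  have h2 : F (b i : FockSpace N) = g • (b i : FockSpace N) := (hmem _).1 (b i).2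
  have h3 : ‖(b i : FockSpace N)‖ = 1 := hon.1 i
  rw [Set.mem_ofPred_eq, h1, h2, inner_smul_right, inner_self_eq_norm_sq_to_K, h3]
  simp

/-- The trace of an orthogonal projection of finite rank. -/
lemma hasSum_inner_projection {H : Type*} [NormedAddCommGroup H] [InnerProductSpace ℂ H]
    {J : Type*} (d : HilbertBasis J ℂ H) {q : ℕ} {e : Fin q → H} (he : ∀ i, ‖e i‖ = 1) :
    HasSum (fun j => inner ℂ (d j) (∑ i, inner ℂ (e i) (d j) • e i)) (q : ℂ) := by
  have h1 : ∀ i ∈ (Finset.univ : Finset (Fin q)),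
      HasSum (fun j => inner ℂ (e i) (d j) * inner ℂ (d j) (e i)) (1 : ℂ) := fun i _ => by
    have := d.hasSum_inner_mul_inner (e i) (e i)
    rwa [inner_self_eq_norm_sq_to_K, he, RCLike.ofReal_one, one_pow] at this
  have h2 := hasSum_sum h1
  simp only [Finset.sum_const, Finset.card_univ, Fintype.card_fin, nsmul_eq_mul, mul_one] at h2
  refine h2.congr_fun fun j => ?_
  rw [inner_sum]
  simp only [inner_smul_right]

end Trace

end Fluxon
namespace Fluxon

/-! ### Fluxons as gauge fields with a ladder basis. -/

section Fluxons

variable {θ : ℝ} {N q : ℕ} {A A' : GaugeField N} {l l' : Fin q → ℂ}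

/-- A ladder basis for the covariant derivatives of a gauge field. -/
abbrev IsFluxonBasis (θ : ℝ) {N q : ℕ} {ι : Type} (A : GaugeField N) (l : Fin q → ℂ)
    (b : HilbertBasis (Fin q ⊕ ℕ × ι) ℂ (FockSpace N)) : Prop :=
  IsLadderBasis (covDbar θ A) (-covD θ A) (1 / (2 * θ)) l b

lemma maps_neg_covD_iff {x y : FockSpace N} :
    Maps (-covD θ A) x y ↔ Maps (covD θ A) x (-y) :=
  exists_congr fun _ => by rw [LinearMap.neg_apply, neg_eq_iff_eq_neg]

/-! ### Gauge fields with a ladder basis are fluxons -/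

/-- The form identity for ladder bases makes the curvature `2iκ` times the projection `P` onto the
`q` eigenvectors, so every condition reduces to a property of `P`. -/
theorem IsFluxonBasis.isFluxon (hθ : 0 < θ)
    {b : HilbertBasis (Fin q ⊕ ℕ × Fin N) ℂ (FockSpace N)} (hb : IsFluxonBasis θ A l b) :
    IsFluxon θ N q A := by
  classical
  have hadj := adjointPair_cov hθ A
  set κ : ℝ := 1 / (2 * θ) with hκ
  have hκ0 : 0 < κ := by positivity
  let P : Operators N := ∑ i, InnerProductSpace.rankOne ℂ (b (.inl i)) (b (.inl i))
  have hP : ∀ x, P x = ∑ i, inner ℂ (b (.inl i)) x • b (.inl i) := fun x => by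
    simp only [P, sum_apply, InnerProductSpace.rankOne_apply]
  have hPP : ∀ x, P (P x) = P x := fun x => by
    rw [hP (P x), hP x]
    refine Finset.sum_congr rfl fun i _ => ?_
    simp only [inner_sum, inner_smul_right, hilbertBasis_inner_eq, Sum.inl.injEq]
    simp
  have hF : ∀ x, ((2 * Complex.I * κ) • P : Operators N) x = (2 * Complex.I * κ) • P x :=
    fun x => rfl
  have htr : ∀ (a t : ℂ), 2 * Real.pi * θ * (a * q) = t → ∀ F : Operators N, (∀ x, F x = a • P x) →
      HasTrace θ F t := by
    rintro a t rfl F hF' d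
    refine (((hasSum_inner_projection d (e := fun i => b (.inl i))
      (fun i => b.orthonormal.1 _)).mul_left a).mul_left _).congr_fun fun p => ?_
    rw [hF', inner_smul_right, hP]
  -- The action is read off from `F² = -4κ² P`, whose trace is `-8πθκ² q`.
  refine ⟨(2 * Complex.I * κ) • P, fun φ ψ => ?_, fun ψ => ?_, ?_,
    4 * Real.pi * θ * κ ^ 2 * q, ?_⟩
  · have h1 := hb.form_eq hadj hκ0.le (Maps.of_coe φ) (Maps.of_coe ψ) (Maps.of_coe φ)
      (Maps.of_coe ψ)
    simp only [LinearMap.neg_apply, inner_neg_neg] at h1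
    have h2 : (1 / (2 * θ) : ℂ) = κ := by
      rw [hκ]
      push_cast
      rfl
    have h3 : inner ℂ (φ : FockSpace N) (P ψ) = ∑ i,
        inner ℂ (φ : FockSpace N) (b (.inl i)) * inner ℂ (b (.inl i)) (ψ : FockSpace N) := by
      rw [hP, inner_sum]
      exact Finset.sum_congr rfl fun i _ => by rw [inner_smul_right, mul_comm]
    rw [h2, h1, hF, inner_smul_right, h3, mul_assoc]
  · have h1 : ∀ {x y}, Maps (covDbar θ A) x y → Maps (covDbar θ A) (P x) (P y) := by
      intro x y hxy
      have h2 : P y = ∑ i, inner ℂ (b (.inl i)) x • (-conj (l i) • b (.inl i)) := by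
        rw [hP]
        refine Finset.sum_congr rfl fun i _ => ?_
        rw [hb.inner_left hadj hxy]
        simp only [ladderWeight, ladderShift, Sum.elim_inl, Sum.map_inl, id, map_neg]
        rw [smul_smul, mul_comm]
      rw [h2, hP]
      exact Maps.sum _ fun i _ => (IsLadderBasis.left_inl hb i).smul _
    have h1' : ∀ {x y}, Maps (-covD θ A) x y → Maps (-covD θ A) (P x) (P y) := by
      intro x y hxy
      have h2 : P y = ∑ i, inner ℂ (b (.inl i)) x • (-l i • b (.inl i)) := by
        rw [hP]
        refine Finset.sum_congr rfl fun i _ => ?_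
        have := hb.inner_right hadj hxy (.inl i)
        simp only [ladderWeight, ladderShift, Sum.elim_inl, Sum.map_inl, id] at this
        rw [this, smul_smul, mul_comm]
      rw [h2, hP]
      exact Maps.sum _ fun i _ => (IsLadderBasis.right_inl hb i).smul _
    have h3 := (h1 (Maps.of_coe ψ)).smul (2 * Complex.I * κ)
    have h4 := (h1' (Maps.of_coe ψ)).smul (2 * Complex.I * κ)
    rw [maps_neg_covD_iff, LinearMap.neg_apply, map_neg, smul_neg, neg_neg] at h4
    exact ⟨h3.mem, h4.2, h3.2⟩
  · refine htr _ _ ?_ _ hF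
    rw [hκ]
    have : (θ : ℂ) ≠ 0 := by exact_mod_cast hθ.ne'
    push_cast
    field_simp
  · refine htr ((2 * Complex.I * κ) * (2 * Complex.I * κ)) _ ?_ _ fun x => ?_
    · push_cast
      linear_combination (8 * Real.pi * θ * κ ^ 2 * q : ℂ) * Complex.I_sq
    · change (2 * Complex.I * κ) • P ((2 * Complex.I * κ) • P x) = _
      rw [map_smul, hPP, smul_smul]

/-! ### Gauge equivalence and ladder bases -/

/-- The unitary matching the two bases intertwines the operators; its inverse does so as well, hence
it preserves the domain in both directions. -/
lemma IsFluxonBasis.gaugeEquiv (hθ : 0 < θ)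
    {b b' : HilbertBasis (Fin q ⊕ ℕ × Fin N) ℂ (FockSpace N)} (hb : IsFluxonBasis θ A l b)
    (hb' : IsFluxonBasis θ A' l b') : GaugeEquiv θ A A' := by
  have h1 := hb.maps_unitary (adjointPair_cov hθ A) hb' (adjointPair_cov hθ A')
  have h2 := hb'.maps_unitary (adjointPair_cov hθ A') hb (adjointPair_cov hθ A)
  refine ⟨b.repr.trans b'.repr.symm, fun ψ => ⟨fun h => ?_, fun h => ?_⟩, fun ψ h => ?_⟩
  · have := (h2.1 _ _ (Maps.of_coe ⟨_, h⟩)).mem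
    simpa using this
  · exact (h1.1 _ _ (Maps.of_coe ⟨_, h⟩)).mem
  · have h3 := h1.2 _ _ (Maps.of_coe ψ)
    rw [maps_neg_covD_iff, LinearMap.neg_apply, map_neg, map_neg, neg_neg] at h3
    exact ⟨h3.2, (h1.1 _ _ (Maps.of_coe ψ)).2⟩

lemma IsFluxonBasis.of_gaugeEquiv (hθ : 0 < θ)
    {b : HilbertBasis (Fin q ⊕ ℕ × Fin N) ℂ (FockSpace N)} (hb : IsFluxonBasis θ A l b)
    (h : GaugeEquiv θ A A') :
    ∃ b' : HilbertBasis (Fin q ⊕ ℕ × Fin N) ℂ (FockSpace N), IsFluxonBasis θ A' l b' := by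
  classical
  obtain ⟨U, hU, hU'⟩ := h
  have hb' : ∀ j, HilbertBasis.ofRepr (U.symm.trans b.repr) j = U (b j) := by
    intro j
    rw [← HilbertBasis.repr_symm_single, ← b.repr_symm_single]
    rfl
  refine ⟨HilbertBasis.ofRepr (U.symm.trans b.repr),
    .of_right (adjointPair_cov hθ A') hb.injective fun j => ?_⟩
  have h1 := hb.right j
  rw [hb', hb', ← map_smul]
  have h2 := (hU' ⟨b j, h1.mem⟩ ((hU _).2 h1.mem)).1
  rw [maps_neg_covD_iff] at h1 ⊢
  rw [h1.2] at h2
  rw [← map_neg]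
  exact ⟨_, h2⟩

lemma IsFluxonBasis.perm (hθ : 0 < θ)
    {b : HilbertBasis (Fin q ⊕ ℕ × Fin N) ℂ (FockSpace N)} (hb : IsFluxonBasis θ A l b)
    (τ : Equiv.Perm (Fin q)) :
    ∃ b' : HilbertBasis (Fin q ⊕ ℕ × Fin N) ℂ (FockSpace N), IsFluxonBasis θ A (l ∘ τ) b' := by
  obtain ⟨b', hb'⟩ := exists_hilbertBasis_reindex b (Equiv.sumCongr τ (Equiv.refl _))
  refine ⟨b', .of_right (adjointPair_cov hθ A) (ladderShift_injective _ _) ?_⟩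
  rintro (i | p)
  · rw [hb', hb']
    exact hb.right (.inl (τ i))
  · rw [hb', hb']
    exact hb.right (.inr p)

lemma covDbar_sub_covDbar (A A' : GaugeField N) (φ : numberDomain N) :
    covDbar θ A φ - covDbar θ A' φ = (connection A - connection A') φ := by
  rw [covDbar_eq, covDbar_eq]
  exact add_sub_add_left_eq_sub _ _ _

lemma neg_covD_sub_neg_covD (A A' : GaugeField N) (φ : numberDomain N) :
    (-covD θ A) φ - (-covD θ A') φ =
      ContinuousLinearMap.adjoint (connection A - connection A') φ := by
  rw [neg_covD_eq, neg_covD_eq, map_sub]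
  exact add_sub_add_left_eq_sub _ _ _

lemma norm_neg_covD_sub_le (A A' : GaugeField N) (φ : numberDomain N) :
    ‖(-covD θ A) φ - (-covD θ A') φ‖ ≤
      ‖connection A - connection A'‖ * ‖(φ : FockSpace N)‖ := by
  rw [neg_covD_sub_neg_covD]
  refine (ContinuousLinearMap.le_opNorm _ _).trans_eq ?_
  rw [LinearIsometryEquiv.norm_map]

/-! ### Fluxons have ladder bases -/

/-- `A₀` serves only as a reference field known to have `N` vacua. -/
theorem IsFluxon.exists_fluxonBasis (hθ : 0 < θ) (hN : 1 ≤ N) {A₀ : GaugeField N} {l₀ : Fin q → ℂ}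
    {b₀ : HilbertBasis (Fin q ⊕ ℕ × Fin N) ℂ (FockSpace N)} (hb₀ : IsFluxonBasis θ A₀ l₀ b₀)
    (hA : IsFluxon θ N q A) :
    ∃ (l : Fin q → ℂ) (b : HilbertBasis (Fin q ⊕ ℕ × Fin N) ℂ (FockSpace N)),
      IsFluxonBasis θ A l b := by
  classical
  obtain ⟨F, hcurv, hYM, htr, -⟩ := hA
  obtain ⟨K, hK, hK'⟩ := exists_resolvent hθ A
  have hadj := adjointPair_cov hθ A
  have hκ0 : 0 < 1 / (2 * θ) := by positivity
  set G : Operators N := (2 * Complex.I)⁻¹ • F with hG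
  have h2I : (2 * Complex.I) ≠ 0 := mul_ne_zero two_ne_zero Complex.I_ne_zero
  have hFG : ∀ x, F x = (2 * Complex.I) • G x := fun x => by
    change _ = (2 * Complex.I) • ((2 * Complex.I)⁻¹ • F x)
    rw [smul_smul, mul_inv_cancel₀ h2I, one_smul]
  have hsys : IsYangMillsSystem (covDbar θ A) (-covD θ A) (1 / (2 * θ)) G K :=
    { adj := hadj
      pos := hκ0
      form := fun φ ψ => by
        change inner ℂ _ ((2 * Complex.I)⁻¹ • F ψ) = _
        rw [inner_smul_right, hcurv, ← mul_assoc, inv_mul_cancel₀ h2I, one_mul,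
          LinearMap.neg_apply, LinearMap.neg_apply, inner_neg_neg]
        push_cast
        rfl
      comm_left := by
        rintro x y ⟨hx, rfl⟩
        obtain ⟨h, -, h2⟩ := hYM ⟨x, hx⟩
        have h3 : Maps (covDbar θ A) (F x) (F (covDbar θ A ⟨x, hx⟩)) := ⟨h, h2⟩
        exact h3.smul _
      comm_right := by
        rintro x y ⟨hx, rfl⟩
        obtain ⟨h, h1, -⟩ := hYM ⟨x, hx⟩
        have h3 : Maps (-covD θ A) (F x) (F ((-covD θ A) ⟨x, hx⟩)) := by
          rw [maps_neg_covD_iff, LinearMap.neg_apply, map_neg, neg_neg]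
          exact ⟨h, h1⟩
        exact h3.smul _
      compact := hK
      resolvent := hK'
      finite := fun g hg => by
        have := finiteDimensional_of_hasTrace hθ hN htr (mul_ne_zero h2I hg)
        refine Submodule.finiteDimensional_of_le (S₂ := Module.End.eigenspace
          (F : FockSpace N →ₗ[ℂ] FockSpace N) (2 * Complex.I * g)) fun x hx => ?_
        rw [Module.End.mem_eigenspace_iff] at hx ⊢
        change G x = g • x at hx
        change F x = _
        rw [hFG, hx, smul_smul] }
  obtain ⟨q', m, l, b, hb, hG1, hG2⟩ := hsys.exists_ladderBasis
  -- The two covariant derivatives differ by a bounded operator, so vacua can be compared both ways.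
  have hm : m = N := by
    apply le_antisymm
    · have := IsLadderBasis.card_le hb hadj hb₀ (adjointPair_cov hθ A₀) hκ0
        (C := ‖connection A - connection A₀‖) fun φ => by
          rw [covDbar_sub_covDbar]
          exact ContinuousLinearMap.le_opNorm _ _
      simpa using this
    · have := IsLadderBasis.card_le hb₀ (adjointPair_cov hθ A₀) hb hadj hκ0
        (C := ‖connection A₀ - connection A‖) fun φ => by
          rw [covDbar_sub_covDbar]
          exact ContinuousLinearMap.le_opNorm _ _
      simpa using this
  subst hm
  have hGx : ∀ x, G x = ((1 / (2 * θ) : ℝ) : ℂ) • ∑ i, inner ℂ (b (.inl i)) x • b (.inl i) := by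
    intro x
    refine hilbertBasis_ext b ?_
    rintro (i | p)
    · rw [← hsys.symm_G, hG1, inner_smul_left, Complex.conj_ofReal, inner_smul_right, inner_sum]
      simp only [inner_smul_right, hilbertBasis_inner_eq, Sum.inl.injEq]
      simp
    · rw [← hsys.symm_G, hG2, inner_zero_left, inner_smul_right, inner_sum]
      simp only [inner_smul_right, hilbertBasis_inner_eq, reduceCtorEq]
      simp
  -- `F` is now `2iκ` times a projection of rank `q'`, whose trace `2πi q'` must be the prescribed
  -- one.
  have hq : q' = q := by
    have h1 := htr (standardBasis _)
    have h2 := ((hasSum_inner_projection (standardBasis (ℕ × Fin m)) (e := fun i => b (.inl i))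
      (fun i => b.orthonormal.1 _)).mul_left
        (2 * Real.pi * θ * (2 * Complex.I * ((1 / (2 * θ) : ℝ) : ℂ)))).congr_fun
        (g := fun p => 2 * Real.pi * θ * inner ℂ (standardBasis _ p) (F (standardBasis _ p)))
        fun p => by
          rw [hFG, hGx, inner_smul_right, inner_smul_right]
          ring
    have h3 := h2.unique h1
    have h4 : (θ : ℂ) ≠ 0 := by exact_mod_cast hθ.ne'
    have h5 : (Real.pi : ℂ) ≠ 0 := by exact_mod_cast Real.pi_ne_zero
    have h6 := Complex.I_ne_zero
    push_cast at h3
    field_simp at h3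
    exact_mod_cast h3
  subst hq
  exact ⟨l, b, hb⟩

/-! ### Dependence of the positions on the gauge field -/

/-- Used twice: with equal gauge fields it makes the positions unique up to order, with nearby ones
it gives continuity of the inverse. -/
lemma exists_perm_positions (N q : ℕ) (hθ : 0 < θ) : ∃ ε₀ > 0,
    ∀ (A A' : GaugeField N) (l l' : Fin q → ℂ)
      (b b' : HilbertBasis (Fin q ⊕ ℕ × Fin N) ℂ (FockSpace N)),
      IsFluxonBasis θ A l b → IsFluxonBasis θ A' l' b' → ‖connection A - connection A'‖ ≤ ε₀ →
      ∃ τ : Equiv.Perm (Fin q), ∀ i,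
        ‖l (τ i) - l' i‖ ≤ 2 * q.factorial * ‖connection A - connection A'‖ := by
  obtain ⟨ε₀, hε₀, h⟩ := exists_perm_eigenvalues (𝒟 := numberDomain N) (ι := Fin N) q
    (κ := 1 / (2 * θ)) (by positivity)
  exact ⟨ε₀, hε₀, fun A A' l l' b b' hb hb' hA => h _ _ _ _ l l' b b' _ (adjointPair_cov hθ A)
    (adjointPair_cov hθ A') hb hb' (norm_nonneg _) hA (norm_neg_covD_sub_le A A')⟩

end Fluxons
end Fluxon
namespace Fluxon

/-! ### The explicit fluxons -/

section Standard

variable {θ : ℝ} {N q : ℕ}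

/-- The gauge field with a given bounded part of `D̄`. -/
def gaugeFieldOf {N : ℕ} (X : Operators N) : GaugeField N :=
  ![⟨X - star X, by rw [skewAdjoint.mem_iff, star_sub, star_star, neg_sub]⟩,
    ⟨-Complex.I • (X + star X), by
      rw [skewAdjoint.mem_iff, star_smul, star_add, star_star, star_neg, RCLike.star_def,
        Complex.conj_I, neg_neg, neg_smul, neg_neg, add_comm]⟩]

lemma connection_gaugeFieldOf (X : Operators N) : connection (gaugeFieldOf X) = X := by
  change (1 / 2 : ℂ) • ((X - star X) + Complex.I • (-Complex.I • (X + star X))) = X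
  rw [smul_smul, mul_neg, Complex.I_mul_I, neg_neg, one_smul, sub_add_add_cancel, ← two_smul ℂ X,
    smul_smul]
  norm_num

lemma continuous_gaugeFieldOf : Continuous (gaugeFieldOf (N := N)) := by
  refine continuous_pi fun i => ?_
  fin_cases i
  · exact Continuous.subtype_mk (by fun_prop) _
  · exact Continuous.subtype_mk (by fun_prop) _

lemma continuous_connection : Continuous (connection (N := N)) := by
  unfold connection
  fun_prop

/-- The relabelling of the number basis: `Fin q` labels the first `q` states of the first copy
of the Fock module. -/
def positionIndex (q : ℕ) (hN : 1 ≤ N) : Fin q ⊕ ℕ × Fin N → ℕ × Fin N :=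
  Sum.elim (fun i => (i, ⟨0, hN⟩)) fun p => if p.2.val = 0 then (p.1 + q, p.2) else p

lemma positionIndex_bijective (q : ℕ) (hN : 1 ≤ N) :
    Function.Bijective (positionIndex q hN) := by
  constructor
  · rintro (i | ⟨n, k⟩) (j | ⟨n', k'⟩) h
    · simp only [positionIndex, Sum.elim_inl, Prod.mk.injEq, and_true] at h
      rw [Fin.ext h]
    · simp only [positionIndex, Sum.elim_inl, Sum.elim_inr] at h
      split_ifs at h with hk
      · have := congrArg Prod.fst h
        simp only at this
        omega
      · exact absurd (congrArg (fun p => p.2.val) h).symm hk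
    · simp only [positionIndex, Sum.elim_inl, Sum.elim_inr] at h
      split_ifs at h with hk
      · have := congrArg Prod.fst h
        simp only at this
        omega
      · exact absurd (congrArg (fun p => p.2.val) h) hk
    · simp only [positionIndex, Sum.elim_inr] at h
      split_ifs at h with hk hk' hk' <;> simp only [Prod.mk.injEq] at h
      · rw [h.2, Nat.add_right_cancel h.1]
      · exact absurd (h.2 ▸ hk) hk'
      · exact absurd (h.2 ▸ hk') hk
      · rw [h.1, h.2]
  · rintro ⟨n, k⟩
    by_cases hk : k.val = 0
    · rcases lt_or_ge n q with hn | hn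
      · exact ⟨.inl ⟨n, hn⟩, Prod.ext rfl (Fin.ext hk.symm)⟩
      · refine ⟨.inr (n - q, k), ?_⟩
        simp only [positionIndex, Sum.elim_inr, if_pos hk]
        rw [Nat.sub_add_cancel hn]
    · exact ⟨.inr (n, k), by simp only [positionIndex, Sum.elim_inr, if_neg hk]⟩

/-- The weights of the creation operator of the explicit fluxon. -/
def creationWeight (θ : ℝ) (q : ℕ) (p : ℕ × Fin N) : ℝ :=
  if p.2.val = 0 then if p.1 < q then 0 else √((((p.1 - q : ℕ) : ℝ) + 1) * (1 / (2 * θ)))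
  else √(((p.1 : ℝ) + 1) * (1 / (2 * θ)))

/-- Moving the ladder up by `q` steps is a bounded perturbation because `√(x + y) ≤ √x + √y`; for
the `q` removed levels the whole weight is at most `√(qκ)`. -/
lemma norm_creationWeight_sub_le (hθ : 0 < θ) (q : ℕ) (p : ℕ × Fin N) :
    ‖((creationWeight θ q p - √(((p.1 : ℝ) + 1) * (1 / (2 * θ))) : ℝ) : ℂ)‖ ≤
      √(q * (1 / (2 * θ))) := by
  have hκ : 0 < 1 / (2 * θ) := by positivity
  rw [Complex.norm_real, Real.norm_eq_abs, creationWeight]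
  split_ifs with hk hn
  · rw [zero_sub, abs_neg, abs_of_nonneg (Real.sqrt_nonneg _)]
    refine Real.sqrt_le_sqrt (mul_le_mul_of_nonneg_right ?_ hκ.le)
    exact_mod_cast hn
  · have h1 : ((p.1 - q : ℕ) : ℝ) = (p.1 : ℝ) - q := Nat.cast_sub (not_lt.1 hn)
    have h2 : √(((p.1 : ℝ) + 1) * (1 / (2 * θ))) ≤
        √((((p.1 - q : ℕ) : ℝ) + 1) * (1 / (2 * θ))) + √(q * (1 / (2 * θ))) := by
      have ha : 0 ≤ (((p.1 - q : ℕ) : ℝ) + 1) * (1 / (2 * θ)) := by positivity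
      have hb : 0 ≤ q * (1 / (2 * θ)) := by positivity
      refine Real.sqrt_le_iff.2 ⟨by positivity, ?_⟩
      have h3 : ((p.1 : ℝ) + 1) * (1 / (2 * θ)) =
          (((p.1 - q : ℕ) : ℝ) + 1) * (1 / (2 * θ)) + q * (1 / (2 * θ)) := by
        rw [h1]
        ring
      rw [h3, add_sq, Real.sq_sqrt ha, Real.sq_sqrt hb]
      linarith [mul_nonneg (Real.sqrt_nonneg ((((p.1 - q : ℕ) : ℝ) + 1) * (1 / (2 * θ))))
        (Real.sqrt_nonneg (q * (1 / (2 * θ))))]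
    have h3 : √((((p.1 - q : ℕ) : ℝ) + 1) * (1 / (2 * θ))) ≤ √(((p.1 : ℝ) + 1) * (1 / (2 * θ))) := by
      refine Real.sqrt_le_sqrt (mul_le_mul_of_nonneg_right ?_ hκ.le)
      have : (0 : ℝ) ≤ q := Nat.cast_nonneg q
      rw [h1]
      linarith
    rw [abs_le]
    constructor <;> linarith [Real.sqrt_nonneg (q * (1 / (2 * θ)))]
  · rw [sub_self, abs_zero]
    exact Real.sqrt_nonneg _

/-- The bounded part of `D̄` for the explicit fluxon with positions `l`. -/
def standardConnection (hθ : 0 < θ) (hN : 1 ≤ N) (l : Fin q → ℂ) : Operators N :=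
  weightedShift levelUp_injective (Real.sqrt_nonneg _) (norm_creationWeight_sub_le hθ q) -
    ∑ i, conj (l i) • InnerProductSpace.rankOne ℂ
      (standardBasis (ℕ × Fin N) ((i : ℕ), ⟨0, hN⟩)) (standardBasis (ℕ × Fin N) ((i : ℕ), ⟨0, hN⟩))

lemma continuous_standardConnection (hθ : 0 < θ) (hN : 1 ≤ N) :
    Continuous (standardConnection (q := q) hθ hN) := by
  unfold standardConnection
  refine continuous_const.sub (continuous_finsetSum _ fun i _ => ?_)
  exact (Complex.continuous_conj.comp (continuous_apply i)).smul continuous_const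

lemma maps_creation (hθ : 0 < θ) (hN : 1 ≤ N) (l : Fin q → ℂ) (p : ℕ × Fin N) :
    Maps (-covD θ (gaugeFieldOf (standardConnection hθ hN l))) (standardBasis _ p)
      ((creationWeight θ q p : ℂ) • standardBasis _ (levelUp N p) -
        ∑ i : Fin q, (if ((i : ℕ), ⟨0, hN⟩) = p then l i else 0) • standardBasis _ p) := by
  classical
  refine ⟨numberBasis_eq p ▸ (numberBasis p).2, ?_⟩
  have h1 : (⟨standardBasis _ p, numberBasis_eq p ▸ (numberBasis p).2⟩ : numberDomain N) =
      numberBasis p := Subtype.ext (numberBasis_eq p).symm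
  rw [h1, neg_covD_eq, connection_gaugeFieldOf]
  change ((1 / √(2 * θ) : ℝ) : ℂ) • creation N (numberBasis p) +
    ContinuousLinearMap.adjoint (standardConnection hθ hN l) (numberBasis p : FockSpace N) = _
  rw [creation_numberBasis, numberBasis_eq]
  have h2 : (1 / √(2 * θ)) * √((p.1 : ℝ) + 1) = √(((p.1 : ℝ) + 1) * (1 / (2 * θ))) := by
    rw [Real.sqrt_mul (show 0 ≤ (p.1 : ℝ) + 1 by positivity), Real.sqrt_div zero_le_one (2 * θ), Real.sqrt_one, mul_comm]
  have h3 : ContinuousLinearMap.adjoint (standardConnection hθ hN l) (standardBasis _ p) =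
      ((creationWeight θ q p - √(((p.1 : ℝ) + 1) * (1 / (2 * θ))) : ℝ) : ℂ) •
        standardBasis _ (levelUp N p) -
        ∑ i : Fin q, (if ((i : ℕ), ⟨0, hN⟩) = p then l i else 0) • standardBasis _ p := by
    refine hilbertBasis_ext (standardBasis _) fun j => ?_
    rw [ContinuousLinearMap.adjoint_inner_right, standardConnection, sub_apply, sum_apply,
      inner_sub_left, sum_inner, inner_sub_right, inner_sum, ← inner_conj_symm,
      inner_standardBasis, weightedShift_apply, ← inner_standardBasis (levelUp N p)]
    congr 1
    · rw [inner_smul_right, map_mul, Complex.conj_ofReal, inner_conj_symm]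
    · refine Finset.sum_congr rfl fun i _ => ?_
      rw [smul_apply, InnerProductSpace.rankOne_apply, inner_smul_left, inner_smul_left,
        Complex.conj_conj, inner_smul_right]
      by_cases hi : ((i : ℕ), (⟨0, hN⟩ : Fin N)) = p
      · rw [if_pos hi, hi, inner_conj_symm, hilbertBasis_inner_eq _ p p, if_pos rfl, mul_one]
      · rw [if_neg hi, hilbertBasis_inner_eq _ _ p, if_neg hi, mul_zero, mul_zero, zero_mul]
  rw [h3, smul_smul, ← Complex.ofReal_mul, h2, ← add_sub_assoc, ← add_smul, ← Complex.ofReal_add,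
    add_sub_cancel]

lemma exists_standard_basis (hθ : 0 < θ) (hN : 1 ≤ N) (l : Fin q → ℂ) :
    ∃ b : HilbertBasis (Fin q ⊕ ℕ × Fin N) ℂ (FockSpace N),
      (∀ j, b j = standardBasis _ (positionIndex q hN j)) ∧
        IsFluxonBasis θ (gaugeFieldOf (standardConnection hθ hN l)) l b := by
  classical
  obtain ⟨b, hb⟩ := exists_hilbertBasis_reindex (standardBasis (ℕ × Fin N))
    (Equiv.ofBijective _ (positionIndex_bijective q hN))
  refine ⟨b, hb, .of_right (adjointPair_cov hθ _) (ladderShift_injective _ _) ?_⟩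
  have hb' : ∀ j, b j = standardBasis _ (positionIndex q hN j) := hb
  rintro (i | ⟨n, k⟩)
  · have h1 := maps_creation hθ hN l ((i : ℕ), ⟨0, hN⟩)
    have h2 : creationWeight θ q ((i : ℕ), (⟨0, hN⟩ : Fin N)) = 0 := by
      simp [creationWeight, i.2]
    rw [h2, Complex.ofReal_zero, zero_smul, zero_sub, Finset.sum_eq_single i, if_pos rfl,
      ← neg_smul] at h1
    · rw [hb', hb']
      exact h1
    · intro j _ hj
      rw [if_neg, zero_smul]
      intro h
      exact hj (Fin.ext (congrArg Prod.fst h))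
    · simp
  · rw [hb', hb']
    have h1 := maps_creation hθ hN l (positionIndex q hN (.inr (n, k)))
    rw [Finset.sum_eq_zero, sub_zero] at h1
    · by_cases hk : k.val = 0
      · have h2 : creationWeight θ q (positionIndex q hN (.inr (n, k))) =
            √(((n : ℝ) + 1) * (1 / (2 * θ))) := by
          simp [creationWeight, positionIndex, hk]
        have h3 : levelUp N (positionIndex q hN (.inr (n, k))) =
            positionIndex q hN (ladderShift q _ (.inr (n, k))) := by
          simp only [positionIndex, levelUp, ladderShift, Sum.elim_inr, Sum.map_inr, Prod.map, id,
            if_pos hk]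
          rw [Nat.succ_add]
        rw [h2, h3] at h1
        exact h1
      · have h2 : creationWeight θ q (positionIndex q hN (.inr (n, k))) =
            √(((n : ℝ) + 1) * (1 / (2 * θ))) := by
          simp [creationWeight, positionIndex, hk]
        have h3 : levelUp N (positionIndex q hN (.inr (n, k))) =
            positionIndex q hN (ladderShift q _ (.inr (n, k))) := by
          simp only [positionIndex, levelUp, ladderShift, Sum.elim_inr, Sum.map_inr, Prod.map, id,
            if_neg hk]
        rw [h2, h3] at h1
        exact h1
    · intro i _
      rw [if_neg, zero_smul]
      intro h
      exact absurd ((positionIndex_bijective q hN).1 (a₁ := .inl i) h) (by simp)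

lemma isStandardFluxon_of_basis {A : GaugeField N} (hN : 1 ≤ N) {l : Fin q → ℂ}
    {b : HilbertBasis (Fin q ⊕ ℕ × Fin N) ℂ (FockSpace N)}
    (hb : ∀ j, b j = standardBasis _ (positionIndex q hN j)) (hA : IsFluxonBasis θ A l b) :
    IsStandardFluxon θ l A := by
  have hval : ∀ {T : numberDomain N →ₗ[ℂ] FockSpace N} {p : ℕ × Fin N} {y : FockSpace N},
      Maps T (standardBasis _ p) y → T (numberBasis p) = y := by
    rintro T p y ⟨h, rfl⟩
    exact congrArg T (Subtype.ext (numberBasis_eq p))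
  have hD : ∀ {j : Fin q ⊕ ℕ × Fin N} {p r : ℕ × Fin N}, positionIndex q hN j = p →
      positionIndex q hN (ladderShift q _ j) = r → covD θ A (numberBasis p) =
        -(ladderWeight (1 / (2 * θ)) l j • (numberBasis r : FockSpace N)) := by
    rintro j p r rfl rfl
    have h1 := hA.right j
    rw [hb, hb, maps_neg_covD_iff] at h1
    rw [hval h1, numberBasis_eq]
  have hDbar : ∀ {j : Fin q ⊕ ℕ × Fin N} {p r : ℕ × Fin N}, positionIndex q hN j = p →
      positionIndex q hN (ladderShift q _ j) = r → covDbar θ A (numberBasis r) =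
        conj (ladderWeight (1 / (2 * θ)) l j) • (numberBasis p : FockSpace N) := by
    rintro j p r rfl rfl
    have h1 := hA.left j
    rw [hb, hb] at h1
    rw [hval h1, numberBasis_eq]
  have hDbar0 : ∀ {k : Fin N} {p : ℕ × Fin N}, positionIndex q hN (.inr (0, k)) = p →
      covDbar θ A (numberBasis p) = 0 := by
    rintro k p rfl
    have h1 := hA.left_zero (.inr (0, k)) (inr_zero_notMem_range k)
    rw [hb] at h1
    exact hval h1
  intro n k
  refine ⟨fun h => ?_, fun hk hn => ?_, fun hk => ?_⟩
  · have h1 : positionIndex q hN (.inl ⟨n, h.2⟩) = (n, k) := Prod.ext rfl (Fin.ext h.1.symm)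
    constructor
    · rw [hD h1 h1]
      simp [ladderWeight]
    · rw [hDbar h1 h1]
      simp [ladderWeight]
  · have hpos : ∀ m, positionIndex q hN (.inr (m, k)) = (m + q, k) := fun m => by
      simp only [positionIndex, Sum.elim_inr, if_pos hk]
    obtain ⟨m, rfl⟩ := Nat.exists_eq_add_of_le' hn
    rw [Nat.add_sub_cancel]
    constructor
    · rw [hD (hpos m) (r := (m + q + 1, k)) (by
        rw [Nat.add_right_comm]
        exact hpos (m + 1))]
      simp [ladderWeight, div_eq_mul_inv]
    -- At the bottom of the ladder the coefficient is `√0`, so the vector labelled `n - 1` is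
    -- irrelevant, even where the subtraction truncates.
    · rcases m with _ | m
      · rw [hDbar0 (hpos 0)]
        simp
      · rw [hDbar (j := .inr (m, k)) (hpos m) (hpos (m + 1)), Nat.add_right_comm, Nat.add_sub_cancel]
        simp [ladderWeight, div_eq_mul_inv]
  · have hpos : ∀ m, positionIndex q hN (.inr (m, k)) = (m, k) := fun m => by
      simp only [positionIndex, Sum.elim_inr, if_neg hk]
    constructor
    · rw [hD (hpos n) (hpos (n + 1))]
      simp [ladderWeight, div_eq_mul_inv]
    · rcases n with _ | n
      · rw [hDbar0 (hpos 0)]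
        simp
      · rw [hDbar (j := .inr (n, k)) (hpos n) (hpos (n + 1)), Nat.add_sub_cancel]
        simp [ladderWeight, div_eq_mul_inv]

/-- The explicit fluxon with positions `l`. -/
def standardFluxon (hθ : 0 < θ) (hN : 1 ≤ N) (l : Fin q → ℂ) : FluxonSpace θ N q :=
  ⟨gaugeFieldOf (standardConnection hθ hN l), by
    obtain ⟨b, -, hb⟩ := exists_standard_basis hθ hN l
    exact hb.isFluxon hθ⟩

lemma exists_fluxonBasis_standardFluxon (hθ : 0 < θ) (hN : 1 ≤ N) (l : Fin q → ℂ) :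
    ∃ b : HilbertBasis (Fin q ⊕ ℕ × Fin N) ℂ (FockSpace N),
      IsFluxonBasis θ (standardFluxon hθ hN l).1 l b := by
  obtain ⟨b, -, hb⟩ := exists_standard_basis hθ hN l
  exact ⟨b, hb⟩

lemma isStandardFluxon_standardFluxon (hθ : 0 < θ) (hN : 1 ≤ N) (l : Fin q → ℂ) :
    IsStandardFluxon θ l (standardFluxon hθ hN l).1 := by
  obtain ⟨b, hb, hb'⟩ := exists_standard_basis hθ hN l
  exact isStandardFluxon_of_basis hN hb hb'

lemma continuous_standardFluxon (hθ : 0 < θ) (hN : 1 ≤ N) :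
    Continuous (standardFluxon (q := q) hθ hN) :=
  (continuous_gaugeFieldOf.comp (continuous_standardConnection hθ hN)).subtype_mk _

end Standard

/-! ### The moduli space -/

section Moduli

lemma dist_planeToComplex (x y : EuclideanSpace ℝ (Fin 2)) :
    dist (planeToComplex x) (planeToComplex y) = dist x y := by
  rw [Complex.dist_eq_re_im, EuclideanSpace.dist_eq, Fin.sum_univ_two, Real.dist_eq, Real.dist_eq,
    sq_abs, sq_abs]
  rfl

lemma continuous_planeToComplex : Continuous planeToComplex :=
  (Isometry.of_dist_eq dist_planeToComplex).continuous

lemma planeToComplex_injective : Function.Injective planeToComplex :=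
  (Isometry.of_dist_eq dist_planeToComplex).injective

lemma planeToComplex_surjective : Function.Surjective planeToComplex :=
  fun z => ⟨!₂[z.re, z.im], rfl⟩

variable {θ : ℝ} {N q : ℕ}

/-- The gauge class of the explicit fluxon with given positions. -/
def moduliMap (hθ : 0 < θ) (hN : 1 ≤ N) (q : ℕ) :
    SymmetricProduct (EuclideanSpace ℝ (Fin 2)) q → ModuliSpace θ N q :=
  Quotient.lift
    (fun x => Quotient.mk (gaugeSetoid θ N q) (standardFluxon hθ hN fun i => planeToComplex (x i)))
    (by
      rintro x _ ⟨τ, rfl⟩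
      obtain ⟨b, hb⟩ := exists_fluxonBasis_standardFluxon hθ hN fun i => planeToComplex (x i)
      obtain ⟨c, hc⟩ := exists_fluxonBasis_standardFluxon hθ hN fun i => planeToComplex ((x ∘ τ) i)
      obtain ⟨b', hb'⟩ := hb.perm hθ τ
      exact Quotient.sound (IsFluxonBasis.gaugeEquiv hθ hb' hc))

lemma continuous_moduliMap (hθ : 0 < θ) (hN : 1 ≤ N) : Continuous (moduliMap hθ hN q) :=
  Continuous.quotient_lift (continuous_quotient_mk'.comp ((continuous_standardFluxon hθ hN).comp
    (continuous_pi fun i => continuous_planeToComplex.comp (continuous_apply i)))) _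

lemma mk_eq_mk_of_perm {x y : Fin q → EuclideanSpace ℝ (Fin 2)} {τ : Equiv.Perm (Fin q)}
    (h : ∀ i, x (τ i) = y i) : (Quotient.mk (permSetoid _ q) x) = Quotient.mk _ y :=
  Quotient.sound ⟨τ, funext fun i => (h i).symm⟩

/-- A gauge transformation carries the first ladder basis to a second one for the other fluxon; the
perturbation estimate at distance zero then matches the positions. -/
lemma moduliMap_injective (hθ : 0 < θ) (hN : 1 ≤ N) : Function.Injective (moduliMap hθ hN q) := by
  intro X Y
  induction X using Quotient.inductionOn with | _ x
  induction Y using Quotient.inductionOn with | _ y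
  intro h
  obtain ⟨b, hb⟩ := exists_fluxonBasis_standardFluxon hθ hN fun i => planeToComplex (x i)
  obtain ⟨c, hc⟩ := exists_fluxonBasis_standardFluxon hθ hN fun i => planeToComplex (y i)
  obtain ⟨b', hb'⟩ := hb.of_gaugeEquiv hθ (Quotient.exact h)
  obtain ⟨ε₀, hε₀, hperm⟩ := exists_perm_positions (θ := θ) N q hθ
  obtain ⟨τ, hτ⟩ := hperm _ _ _ _ b' c hb' hc (by
    rw [sub_self, norm_zero]
    exact hε₀.le)
  refine mk_eq_mk_of_perm (τ := τ) fun i => planeToComplex_injective ?_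
  have := hτ i
  rw [sub_self, norm_zero, mul_zero] at this
  exact sub_eq_zero.1 (norm_le_zero_iff.1 this)

lemma exists_positions (hθ : 0 < θ) (hN : 1 ≤ N) (A : FluxonSpace θ N q) :
    ∃ (x : Fin q → EuclideanSpace ℝ (Fin 2))
      (b : HilbertBasis (Fin q ⊕ ℕ × Fin N) ℂ (FockSpace N)),
      IsFluxonBasis θ A.1 (fun i => planeToComplex (x i)) b ∧
        moduliMap hθ hN q (Quotient.mk _ x) = Quotient.mk _ A := by
  obtain ⟨b₀, hb₀⟩ := exists_fluxonBasis_standardFluxon hθ hN (fun _ : Fin q => 0)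
  obtain ⟨l, b, hb⟩ := IsFluxon.exists_fluxonBasis hθ hN hb₀ A.2
  choose x hx using fun i => planeToComplex_surjective (l i)
  obtain rfl : (fun i => planeToComplex (x i)) = l := funext hx
  obtain ⟨c, hc⟩ := exists_fluxonBasis_standardFluxon hθ hN fun i => planeToComplex (x i)
  exact ⟨x, b, hb, Quotient.sound (IsFluxonBasis.gaugeEquiv hθ hc hb)⟩

lemma moduliMap_surjective (hθ : 0 < θ) (hN : 1 ≤ N) :
    Function.Surjective (moduliMap hθ hN q) := by
  intro Y
  induction Y using Quotient.inductionOn with | _ A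
  obtain ⟨x, -, -, hx⟩ := exists_positions hθ hN A
  exact ⟨_, hx⟩

/-- The homeomorphism between the symmetric product of the plane and the moduli space. -/
def moduliHomeomorph (hθ : 0 < θ) (hN : 1 ≤ N) (q : ℕ) :
    SymmetricProduct (EuclideanSpace ℝ (Fin 2)) q ≃ₜ ModuliSpace θ N q where
  toEquiv := Equiv.ofBijective (moduliMap hθ hN q)
    ⟨moduliMap_injective hθ hN, moduliMap_surjective hθ hN⟩
  continuous_toFun := continuous_moduliMap hθ hN
  continuous_invFun := by
    set e := Equiv.ofBijective (moduliMap hθ hN q)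
      ⟨moduliMap_injective hθ hN, moduliMap_surjective hθ hN⟩ with he
    have hsymm : ∀ (A : FluxonSpace θ N q) x, moduliMap hθ hN q x = Quotient.mk _ A →
        e.symm (Quotient.mk _ A) = x := fun A x h => e.symm_apply_eq.2 h.symm
    change Continuous e.symm
    -- By the quotient topology, continuity is tested on fluxons before passing to gauge classes.
    rw [isQuotientMap_quotient_mk'.continuous_iff, continuous_iff_continuousAt]
    intro A V hV
    obtain ⟨x, b, hb, hx⟩ := exists_positions hθ hN A
    change V ∈ nhds (e.symm (Quotient.mk _ A)) at hV
    rw [hsymm A _ hx] at hV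
    have hV' := continuous_quotient_mk'.continuousAt.preimage_mem_nhds hV
    obtain ⟨r, hr, hball⟩ := Metric.mem_nhds_iff.1 hV'
    obtain ⟨ε₀, hε₀, hperm⟩ := exists_perm_positions (θ := θ) N q hθ
    have hfac : (0 : ℝ) < 2 * q.factorial := by
      have := q.factorial_pos
      positivity
    have hcont : Continuous fun A' : FluxonSpace θ N q => ‖connection A.1 - connection A'.1‖ :=
      (continuous_const.sub (continuous_connection.comp continuous_subtype_val)).norm
    -- The first bound makes the estimate applicable; the second turns its factor `2 q!` into a
    -- displacement smaller than `r`.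
    have hev := hcont.continuousAt (x := A) |>.eventually_lt (g := fun _ => min ε₀ (r / (2 * q.factorial)))
      continuousAt_const (by
        rw [sub_self, norm_zero]
        exact lt_min hε₀ (div_pos hr hfac))
    change ∀ᶠ A' in nhds A, e.symm (Quotient.mk _ A') ∈ V
    filter_upwards [hev] with A' hA'
    obtain ⟨x', b', hb', hx'⟩ := exists_positions hθ hN A'
    obtain ⟨τ, hτ⟩ := hperm _ _ _ _ b b' hb hb' (hA'.le.trans (min_le_left _ _))
    -- The estimate yields closeness only after reordering, which does not change the orbit of `x'`.
    have h1 : (Quotient.mk (permSetoid _ q) (x' ∘ τ.symm)) = Quotient.mk _ x' :=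
      mk_eq_mk_of_perm (τ := τ) fun i => by simp
    rw [hsymm A' _ hx', ← h1]
    refine hball ?_
    rw [Metric.mem_ball, dist_pi_lt_iff hr]
    intro i
    have h2 := hτ (τ.symm i)
    rw [Equiv.apply_symm_apply] at h2
    rw [dist_comm, ← dist_planeToComplex, dist_eq_norm]
    refine h2.trans_lt ?_
    have h3 := hA'.trans_le (min_le_right _ _)
    rw [lt_div_iff₀ hfac] at h3
    linarith

end Moduli
end Fluxon
end

theorem mainTheorem12 (θ : ℝ) (hθ : 0 < θ) (N q : ℕ) (hN : 1 ≤ N) :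
    ∃ Ψ : Fluxon.SymmetricProduct (EuclideanSpace ℝ (Fin 2)) q ≃ₜ Fluxon.ModuliSpace θ N q,
      ∀ x : Fin q → EuclideanSpace ℝ (Fin 2),
        ∃ A : Fluxon.FluxonSpace θ N q,
          Fluxon.IsStandardFluxon θ (fun i => Fluxon.planeToComplex (x i)) A.1 ∧
          Ψ (Quotient.mk (Fluxon.permSetoid (EuclideanSpace ℝ (Fin 2)) q) x) =
            Quotient.mk (Fluxon.gaugeSetoid θ N q) A := by
  exact ⟨Fluxon.moduliHomeomorph hθ hN q, fun _ =>
    ⟨_, Fluxon.isStandardFluxon_standardFluxon hθ hN _, rfl⟩⟩
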